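/- Let $(N,\langle\cdot,\cdot\rangle)$ be a smooth 4-dimensional spacetime (Lorentzian metric of signature $(-,+,+,+)$). Let $(M,g,k)$ be an initial data set with global coordinates $(x^1,x^2,x^3)$ that identify $M$ with an open subset of $\mathbb R^3$, so that $M$ is a spacelike hypersurface in $N$ with future unit normal $e_4$, induced metric $g$ and second fundamental form $k(Y,Z)=\langle\nabla_Y e_4,Z\rangle$. Suppose that in these coordinates the metric is conformally flat, $g=u^4\delta$, with $u>0$ smooth. Let $r>0$ be such that the coordinate sphere $\Sigma_r=\{|x|=r\}$ lies in $M$, and let $e_3$ be its outward unit normal in $M$. Write points of $\Sigma_r$ as $x=r\tilde X$ with $\tilde X=(\tilde X^1,\tilde X^2,\tilde X^3)\in S^2$, let $(u^1,u^2)$ be any local coordinates on $S^2$, $\partial_a=\partial/\partial u^a$, let $\tilde\sigma_{ab}=\partial_a\tilde X\cdot\partial_b\tilde X$ be the round metric of $S^2$, and let $k_{ra}=k(\partial_r,\partial_a)=r\,k_{ij}\tilde X^i\,\partial_a\tilde X^j$. Put $$\bar h=2r^{-1}u^{-2}-2\,\partial_r(u^{-2}),\qquad p=u^{-4}k_{ij}(\delta^{ij}-\tilde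 X^i\tilde X^j).$$ For the surface $\Sigma_r$ in $N$ let $\sigma$ be the induced metric and $H=\sigma^{ab}(\nabla_a\partial_b)^\perp$ the mean curvature vector. Where $H$ is spacelike, let $|H|=\sqrt{\langle H,H\rangle}$ and $$\alpha_H(\cdot)=\Big\langle\nabla^N_{(\cdot)}\frac{J}{|H|},\frac{H}{|H|}\Big\rangle,$$ where $\nabla^N$ is the connection of the normal bundle and $J$ is the reflection of $H$ through the incoming light cone in the normal bundle (the linear reflection that fixes $e_4-e_3$ and negates $e_4+e_3$). Then on $\Sigma_r$ $$\sigma_{ab}=u^4r^2\,\tilde\sigma_{ab},$$ and wherever $H$ is spacelike, $\bar h^2-p^2>0$ and $$|H|=\sqrt{\bar h^2-p^2},\qquad (\alpha_H)_a=\frac{\bar h\,\partial_a p-p\,\partial_a\bar h}{\bar h^2-p^2}-u^{-2}k_{ra}.$$ -/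

import Mathlib

open scoped Manifold ContDiff Matrix

noncomputable section

/-- `ℝᵐ` with its Euclidean structure. -/
abbrev Eu (m : ℕ) : Type := EuclideanSpace ℝ (Fin m)

/-- The standard basis vectors of `ℝᵐ`. -/
def stdVec {m : ℕ} (i : Fin m) : Eu m := EuclideanSpace.single i 1

/-- The partial derivative `∂ᵢ f` of a map from `ℝᵐ` to a normed space. -/
def pderiv {m : ℕ} {E : Type*} [NormedAddCommGroup E] [NormedSpace ℝ E]
    (f : Eu m → E) (q : Eu m) (i : Fin m) : E :=
  fderiv ℝ f q (stdVec i)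

section Spacetime

variable {N : Type*} [TopologicalSpace N] [ChartedSpace (Eu 4) N]

/-- The coordinate vector `∂ᵢΦ ∈ T_{Φ q}N` of a map `Φ : ℝᵐ → N`. -/
def coordVec {m : ℕ} (Φ : Eu m → N) (q : Eu m) (i : Fin m) : TangentSpace (𝓡 4) (Φ q) :=
  mfderiv (𝓡 m) (𝓡 4) Φ q (stdVec i)

/-- The components `G_{ij}` at `y`, in the chart around `x₀`, of a field `G` of bilinear forms. -/
def chartMetric (G : ∀ x : N, LinearMap.BilinForm ℝ (TangentSpace (𝓡 4) x)) (x₀ : N) (y : Eu 4) :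
    Matrix (Fin 4) (Fin 4) ℝ :=
  Matrix.of fun i j =>
    G ((extChartAt (𝓡 4) x₀).symm y)
      (coordVec (extChartAt (𝓡 4) x₀).symm y i) (coordVec (extChartAt (𝓡 4) x₀).symm y j)

variable (N) in
/-- A smooth Lorentzian metric, of signature `(-,+,+,+)`, on the 4-manifold `N`. -/
structure LorentzMetric where
  /-- the metric on each tangent space -/
  val : ∀ x : N, LinearMap.BilinForm ℝ (TangentSpace (𝓡 4) x)
  symm : ∀ x v w, val x v w = val x w v
  signature : ∀ x, ∃ b : Module.Basis (Fin 4) ℝ (TangentSpace (𝓡 4) x),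
    ∀ i j, val x (b i) (b j) = if i = j then (if i = 0 then -1 else 1) else 0
  smooth : ∀ x₀ i j,
    ContDiffOn ℝ ∞ (fun y => chartMetric val x₀ y i j) (extChartAt (𝓡 4) x₀).target

namespace LorentzMetric

variable (G : LorentzMetric N)

/-- The Christoffel symbol `Γᵏᵢⱼ = ½ Gᵏˡ (∂ᵢ Gⱼₗ + ∂ⱼ Gᵢₗ - ∂ₗ Gᵢⱼ)` in the chart around `x₀`. -/
def christoffel (x₀ : N) (y : Eu 4) (k i j : Fin 4) : ℝ :=
  (1 / 2) * ∑ l, (chartMetric G.val x₀ y)⁻¹ k l *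
    (pderiv (fun z => chartMetric G.val x₀ z j l) y i
      + pderiv (fun z => chartMetric G.val x₀ z i l) y j
      - pderiv (fun z => chartMetric G.val x₀ z i j) y l)

/-- The Levi-Civita covariant derivative `∇ₐV` of a vector field `V` along a map `Φ : ℝᵐ → N`, in
the coordinate direction `a`. It is computed in the chart `φ` of `N` around `Φ q`, where it reads
`∂ₐVᵏ + Γᵏᵢⱼ ∂ₐΦⁱ Vʲ`. -/
def covDeriv {m : ℕ} (Φ : Eu m → N) (V : ∀ q, TangentSpace (𝓡 4) (Φ q)) (q : Eu m) (a : Fin m) :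
    TangentSpace (𝓡 4) (Φ q) :=
  let φ := extChartAt (𝓡 4) (Φ q)
  let Φc : Eu m → Eu 4 := fun q' => φ (Φ q')
  let Vc : Eu m → Eu 4 := fun q' => mfderiv (𝓡 4) (𝓡 4) φ (Φ q') (V q')
  ∑ k, (pderiv Vc q a k
      + ∑ i, ∑ j, G.christoffel (Φ q) (Φc q) k i j * pderiv Φc q a i * Vc q j) •
    (mfderiv (𝓡 4) (𝓡 4) φ (Φ q)).inverse (stdVec k)

/-- The components of the metric induced on the source of `Φ : ℝᵐ → N`. -/
def inducedMetric {m : ℕ} (Φ : Eu m → N) (q : Eu m) : Matrix (Fin m) (Fin m) ℝ :=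
  Matrix.of fun a b => G.val (Φ q) (coordVec Φ q a) (coordVec Φ q b)

/-- The part of `v ∈ T_{Φ q}N` normal to the immersion `Φ`. -/
def normalPart {m : ℕ} (Φ : Eu m → N) (q : Eu m) (v : TangentSpace (𝓡 4) (Φ q)) :
    TangentSpace (𝓡 4) (Φ q) :=
  v - ∑ a, ∑ b, ((G.inducedMetric Φ q)⁻¹ a b * G.val (Φ q) v (coordVec Φ q a)) • coordVec Φ q b

/-- The second fundamental form `k(∂ᵢ, ∂ⱼ) = ⟨∇ᵢ n, ∂ⱼ⟩` with respect to the normal field `n`. -/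
def secondFundamentalForm {m : ℕ} (F : Eu m → N) (n : ∀ x, TangentSpace (𝓡 4) (F x)) (x : Eu m) :
    Matrix (Fin m) (Fin m) ℝ :=
  Matrix.of fun i j => G.val (F x) (G.covDeriv F n x i) (coordVec F x j)

/-- The mean curvature vector `H = σᵃᵇ (∇ₐ ∂_b Φ)^⊥` of a spacelike immersion `Φ`. -/
def meanCurvature {m : ℕ} (Φ : Eu m → N) (q : Eu m) : TangentSpace (𝓡 4) (Φ q) :=
  ∑ a, ∑ b, (G.inducedMetric Φ q)⁻¹ a b •
    G.normalPart Φ q (G.covDeriv Φ (fun q' => coordVec Φ q' b) q a)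

/-- `⟨H, H⟩`; the mean curvature vector is spacelike when this is positive. -/
def meanCurvatureSq {m : ℕ} (Φ : Eu m → N) (q : Eu m) : ℝ :=
  G.val (Φ q) (G.meanCurvature Φ q) (G.meanCurvature Φ q)

/-- The norm `|H|` of the (spacelike) mean curvature vector. -/
def meanCurvatureNorm {m : ℕ} (Φ : Eu m → N) (q : Eu m) : ℝ :=
  Real.sqrt (G.meanCurvatureSq Φ q)

/-- The connection `∇ᴺ` of the normal bundle of `Φ`. -/
def normalConnection {m : ℕ} (Φ : Eu m → N) (V : ∀ q, TangentSpace (𝓡 4) (Φ q)) (q : Eu m)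
    (a : Fin m) : TangentSpace (𝓡 4) (Φ q) :=
  G.normalPart Φ q (G.covDeriv Φ V q a)

/-- In the Lorentzian plane spanned by the orthonormal pair `e₃` (outward, spacelike) and `e₄`
(future, timelike), the reflection through the incoming light cone: the linear map which fixes the
incoming null vector `e₄ - e₃` and negates the outgoing null vector `e₄ + e₃`. -/
def reflectIncoming {x : N} (e₃ e₄ v : TangentSpace (𝓡 4) x) : TangentSpace (𝓡 4) x :=
  v - (2 * G.val x v (e₄ - e₃) / G.val x (e₄ + e₃) (e₄ - e₃)) • (e₄ + e₃)

/-- The components `(α_H)ₐ = ⟨∇ᴺₐ (J/|H|), H/|H|⟩` of the connection one-form of the normal bundle in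
mean curvature gauge, where `J` is the reflection of `H` through the incoming light cone. -/
def connectionForm {m : ℕ} (Φ : Eu m → N) (e₃ e₄ : ∀ q, TangentSpace (𝓡 4) (Φ q)) (q : Eu m)
    (a : Fin m) : ℝ :=
  G.val (Φ q)
    (G.normalConnection Φ
      (fun q' => (G.meanCurvatureNorm Φ q')⁻¹ •
        G.reflectIncoming (e₃ q') (e₄ q') (G.meanCurvature Φ q')) q a)
    ((G.meanCurvatureNorm Φ q)⁻¹ • G.meanCurvature Φ q)

/-- `F : Ω → N` realizes the initial data `(g, k)`, given on an open set `Ω` of `ℝ³` by components,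
as a spacelike hypersurface of the spacetime `(N, G)`: the induced metric is `g`, the field `n` is
the (future) timelike unit normal, and `k` is the second fundamental form with respect to `n`.
The choice of `n` is the choice of the time orientation. -/
structure RealizesInitialData [IsManifold (𝓡 4) ∞ N] (Ω : Set (Eu 3)) (g k : Eu 3 → Matrix (Fin 3) (Fin 3) ℝ)
    (F : Eu 3 → N) (n : ∀ x, TangentSpace (𝓡 4) (F x)) : Prop where
  smooth_map : ContMDiffOn (𝓡 3) (𝓡 4) ∞ F Ω
  smooth_normal : ContMDiffOn (𝓡 3) (𝓡 4).tangent ∞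
    (fun x => (⟨F x, n x⟩ : TangentBundle (𝓡 4) N)) Ω
  normal_unit : ∀ x ∈ Ω, G.val (F x) (n x) (n x) = -1
  normal_orthogonal : ∀ x ∈ Ω, ∀ i, G.val (F x) (n x) (coordVec F x i) = 0
  metric_eq : ∀ x ∈ Ω, G.inducedMetric F x = g x
  second_eq : ∀ x ∈ Ω, G.secondFundamentalForm F n x = k x

/-- `e₃` is, over `W`, the outward unit normal, in the hypersurface `F`, of the piece of the
coordinate sphere of radius `r` which is parametrized by `q ↦ r • X q`, with `X q` in the unit
sphere. -/
structure IsOutwardUnitNormal (F : Eu 3 → N) (r : ℝ) (W : Set (Eu 2)) (X : Eu 2 → Eu 3)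
    (e₃ : ∀ q, TangentSpace (𝓡 4) (F (r • X q))) : Prop where
  unit : ∀ q ∈ W, G.val (F (r • X q)) (e₃ q) (e₃ q) = 1
  orthogonal : ∀ q ∈ W, ∀ a,
    G.val (F (r • X q)) (e₃ q) (coordVec (fun q' => F (r • X q')) q a) = 0
  outward : ∀ q ∈ W, ∃ ν : Eu 3,
    e₃ q = mfderiv (𝓡 3) (𝓡 4) F (r • X q) ν ∧ 0 < inner ℝ ν (X q)

end LorentzMetric

end Spacetime

/-- Local coordinates `(u¹, u²) ∈ W` on the unit sphere `S²`, given by the position vector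
`X = (X̃¹, X̃², X̃³)` as a function of them. -/
structure IsSphereCoordinates (W : Set (Eu 2)) (X : Eu 2 → Eu 3) : Prop where
  isOpen : IsOpen W
  smooth : ContDiffOn ℝ ∞ X W
  norm_eq_one : ∀ q ∈ W, ‖X q‖ = 1
  immersion : ∀ q ∈ W, LinearIndependent ℝ (fun a : Fin 2 => pderiv X q a)

/-- The round metric `σ̃_{ab}` of `S²` in the coordinates given by `X`. -/
def roundMetric (X : Eu 2 → Eu 3) (q : Eu 2) : Matrix (Fin 2) (Fin 2) ℝ :=
  Matrix.of fun a b => inner ℝ (pderiv X q a) (pderiv X q b)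

/-- `h̄ = 2 r⁻¹ u⁻² - 2 ∂ᵣ(u⁻²)` at the point `r X`, where `X` is a unit vector. -/
def hBar (u : Eu 3 → ℝ) (r : ℝ) (X : Eu 3) : ℝ :=
  2 * r⁻¹ * u (r • X) ^ (-2 : ℤ) - 2 * deriv (fun s : ℝ => u (s • X) ^ (-2 : ℤ)) r

/-- `p = u⁻⁴ kᵢⱼ (δⁱʲ - X̃ⁱ X̃ʲ)` at the point `r X`, where `X` is a unit vector. -/
def pFun (u : Eu 3 → ℝ) (k : Eu 3 → Matrix (Fin 3) (Fin 3) ℝ) (r : ℝ) (X : Eu 3) : ℝ :=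
  u (r • X) ^ (-4 : ℤ) *
    ∑ i, ∑ j, k (r • X) i j * ((if i = j then 1 else 0) - X i * X j)

/-- `k_{ra} = k(∂ᵣ, ∂ₐ)` on the sphere of radius `r`, where `∂ᵣ = X̃` and `∂ₐ = r ∂ₐX̃`. -/
def kRadial (k : Eu 3 → Matrix (Fin 3) (Fin 3) ℝ) (r : ℝ) (X : Eu 2 → Eu 3) (q : Eu 2)
    (a : Fin 2) : ℝ :=
  ∑ i, ∑ j, k (r • X q) i j * X q i * (r * pderiv X q a j)

end

/-! In the orthonormal normal frame `e₃ = u⁻² ∂ᵣ`, `e₄ = n`, the mean curvature vector of the sphere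
is `H = -h̄ e₃ + p e₄`, and both formulas follow from this.

Of the connection, only locality, linearity, the Leibniz rule, the chain rule under
reparametrization, torsion-freeness and metric compatibility are used; they are checked in charts.
Compatibility moves derivatives between tangent and normal fields: `⟨∇ₐ∂_b, e⟩ = -⟨∇ₐe, ∂_b⟩` for a
normal field `e`. For `e₄` the right side is `-k(∂ₐ, ∂_b)`, and its trace is controlled by the fact
that the inverse round metric represents the tangential projection `δⁱʲ - X̃ⁱX̃ʲ`; this gives `p`.
For `e₃`, Koszul's formula for `u⁴δ` gives `⟨∇ₐe₃, ∂_b⟩ = (r u² + 2r² u ∂ᵣu) σ̃_{ab}`, whose trace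
is `2 r⁻¹ u⁻² + 4 u⁻³ ∂ᵣu = h̄` (`IsConformalSphere.meanCurvature_eq`).

Hence `⟨H, H⟩ = h̄² - p²`, and the reflection sends `H` to `J = h̄ e₄ - p e₃`. In `⟨∇ₐ(J/|H|),
H/|H|⟩` the derivative of `1/|H|` drops out because `J ⊥ H`. The derivatives of the coefficients
give the quotient `(h̄ ∂ₐp - p ∂ₐh̄)/(h̄² - p²)`, and the derivatives of the frame give `-⟨∇ₐe₄, e₃⟩
= -u⁻² k_{ra}` (`connectionForm_eq`). -/

open scoped Topology

noncomputable section

/-! ### Chart components of vectors, metric and Christoffel symbols -/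

section Spacetime

variable {N : Type*} [TopologicalSpace N] [ChartedSpace (Eu 4) N]

/-- The components of a tangent vector at `x` in the chart around `x₀`. -/
def chartCoord (x₀ x : N) : TangentSpace (𝓡 4) x →L[ℝ] Eu 4 :=
  mfderiv (𝓡 4) (𝓡 4) (extChartAt (𝓡 4) x₀) x

theorem hasFDerivAt_eu_apply {m : ℕ} {E : Type*} [NormedAddCommGroup E] [NormedSpace ℝ E] {f : E → Eu m}
    {f' : E →L[ℝ] Eu m} {q : E} (hf : HasFDerivAt f f' q) (k : Fin m) :
    HasFDerivAt (fun z => f z k) ((EuclideanSpace.proj k : Eu m →L[ℝ] ℝ).comp f') q :=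
  (EuclideanSpace.proj k : Eu m →L[ℝ] ℝ).hasFDerivAt.comp q hf

theorem pderiv_apply {m n : ℕ} {f : Eu m → Eu n} {q : Eu m} (hf : DifferentiableAt ℝ f q)
    (i : Fin m) (k : Fin n) : pderiv f q i k = pderiv (fun z => f z k) q i := by
  unfold pderiv
  rw [(hasFDerivAt_eu_apply hf.hasFDerivAt k).fderiv]; rfl

theorem eq_sum_smul_stdVec {m : ℕ} (v : Eu m) : v = ∑ i, v i • (stdVec i : Eu m) := by
  ext j
  simp [stdVec, Finset.sum_apply, Pi.single_apply]

theorem map_eq_sum_stdVec {m : ℕ} {E : Type*} [AddCommGroup E] [Module ℝ E] [TopologicalSpace E]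
    (L : Eu m →L[ℝ] E) (v : Eu m) : L v = ∑ i, v i • L (stdVec i) := by
  conv_lhs => rw [eq_sum_smul_stdVec v]
  simp only [map_sum, map_smul]

theorem mfderiv_eq_sum_coordVec {m : ℕ} (Φ : Eu m → N) (q v : Eu m) :
    mfderiv (𝓡 m) (𝓡 4) Φ q v = ∑ i, v i • coordVec Φ q i :=
  map_eq_sum_stdVec (E := TangentSpace (𝓡 4) (Φ q)) (mfderiv (𝓡 m) (𝓡 4) Φ q) v

variable [IsManifold (𝓡 4) ∞ N]

theorem chartCoord_isInvertible {x₀ x : N} (hx : x ∈ (extChartAt (𝓡 4) x₀).source) :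
    (mfderiv (𝓡 4) (𝓡 4) (extChartAt (𝓡 4) x₀) x).IsInvertible :=
  isInvertible_mfderiv_extChartAt hx

theorem chartCoord_injective {x₀ x : N} (hx : x ∈ (extChartAt (𝓡 4) x₀).source) :
    Function.Injective (chartCoord x₀ x) := by
  obtain ⟨e, he⟩ := chartCoord_isInvertible hx
  intro v w h
  apply e.injective
  have : ∀ v, e v = chartCoord x₀ x v := fun v => by
    unfold chartCoord; rw [← he]; rfl
  rw [this, this, h]

theorem chartCoord_inverse {x₀ x : N} (hx : x ∈ (extChartAt (𝓡 4) x₀).source) (v : Eu 4) :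
    chartCoord x₀ x ((mfderiv (𝓡 4) (𝓡 4) (extChartAt (𝓡 4) x₀) x).inverse v) = v :=
  (chartCoord_isInvertible hx).self_apply_inverse v

/-- The derivatives of the chart and of its inverse compose to the identity. The base point is
written as the image of `y` because the coordinate vectors of the inverse chart live in that tangent
space. -/
theorem eq_sum_chartCoord {x₀ : N} {y : Eu 4} (hy : y ∈ (extChartAt (𝓡 4) x₀).target)
    (v : TangentSpace (𝓡 4) ((extChartAt (𝓡 4) x₀).symm y)) :
    v = ∑ i, (chartCoord x₀ _ v) i • coordVec (extChartAt (𝓡 4) x₀).symm y i := by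
  have h := mfderivWithin_extChartAt_symm_comp_mfderiv_extChartAt (I := 𝓡 4) hy
  rw [ModelWithCorners.range_eq_univ, mfderivWithin_univ] at h
  have h1 := DFunLike.congr_fun h v
  exact h1.symm.trans (mfderiv_eq_sum_coordVec (extChartAt (𝓡 4) x₀).symm y (chartCoord x₀ _ v))

namespace LorentzMetric

variable (G : LorentzMetric N)

theorem val_eq_sum_chartMetric {x₀ x : N} (hx : x ∈ (extChartAt (𝓡 4) x₀).source)
    (v w : TangentSpace (𝓡 4) x) :
    G.val x v w = ∑ i, ∑ j, chartMetric G.val x₀ (extChartAt (𝓡 4) x₀ x) i j *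
      chartCoord x₀ x v i * chartCoord x₀ x w j := by
  obtain ⟨y, hy, rfl⟩ : ∃ y ∈ (extChartAt (𝓡 4) x₀).target, (extChartAt (𝓡 4) x₀).symm y = x :=
    ⟨_, (extChartAt (𝓡 4) x₀).map_source hx, (extChartAt (𝓡 4) x₀).left_inv hx⟩
  rw [(extChartAt (𝓡 4) x₀).right_inv hy]
  conv_lhs => rw [eq_sum_chartCoord hy v, eq_sum_chartCoord hy w]
  simp only [map_sum, LinearMap.sum_apply, map_smul, LinearMap.smul_apply, smul_eq_mul, chartMetric,
    Matrix.of_apply]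
  simp only [Finset.mul_sum]
  rw [Finset.sum_comm]
  refine Finset.sum_congr rfl fun i _ => Finset.sum_congr rfl fun j _ => ?_
  ring

omit [IsManifold (𝓡 4) ∞ N] in
theorem chartMetric_symm (x₀ : N) (y : Eu 4) (i j : Fin 4) :
    chartMetric G.val x₀ y i j = chartMetric G.val x₀ y j i :=
  G.symm _ _ _

omit [IsManifold (𝓡 4) ∞ N] in
theorem eq_zero_of_forall_val_eq_zero {x : N} {v : TangentSpace (𝓡 4) x}
    (h : ∀ w, G.val x v w = 0) : v = 0 := by
  obtain ⟨b, hb⟩ := G.signature x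
  have hv := b.sum_repr v
  have : ∀ j, b.repr v j = 0 := fun j => by
    have h1 := h (b j)
    rw [← hv] at h1
    simp only [map_sum, LinearMap.sum_apply, map_smul, LinearMap.smul_apply, smul_eq_mul, hb] at h1
    simp only [mul_ite, mul_zero, Finset.sum_ite_eq', Finset.mem_univ, if_true] at h1
    split_ifs at h1 <;> simpa using h1
  rw [← hv]; simp [this]

/-- A kernel vector of the component matrix is the chart expression of a tangent vector orthogonal
to everything, which vanishes by nondegeneracy. -/
theorem isUnit_chartMetric {x₀ x : N} (hx : x ∈ (extChartAt (𝓡 4) x₀).source) :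
    IsUnit (chartMetric G.val x₀ (extChartAt (𝓡 4) x₀ x)) := by
  rw [← Matrix.mulVec_injective_iff_isUnit]
  refine (injective_iff_map_eq_zero (Matrix.mulVecLin _)).2 fun c hc => ?_
  have hc' : ∀ i, ∑ j, chartMetric G.val x₀ (extChartAt (𝓡 4) x₀ x) i j * c j = 0 :=
    fun i => congrFun hc i
  set v := (mfderiv (𝓡 4) (𝓡 4) (extChartAt (𝓡 4) x₀) x).inverse (WithLp.toLp 2 c) with hv
  have hcv : chartCoord x₀ x v = WithLp.toLp 2 c := chartCoord_inverse hx _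
  have : v = 0 := G.eq_zero_of_forall_val_eq_zero fun w => by
    rw [G.symm, G.val_eq_sum_chartMetric hx, hcv]
    refine Finset.sum_eq_zero fun i _ => ?_
    have : ∀ j, chartMetric G.val x₀ (extChartAt (𝓡 4) x₀ x) i j * chartCoord x₀ x w i * c j
      = chartCoord x₀ x w i * (chartMetric G.val x₀ (extChartAt (𝓡 4) x₀ x) i j * c j) :=
      fun j => by ring
    simp only [this, ← Finset.mul_sum, hc', mul_zero]
  rw [this, map_zero] at hcv
  funext j
  have := congrArg (fun f : Eu 4 => f j) hcv
  simpa using this.symm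

theorem sum_chartMetric_mul_christoffel {x₀ x : N} (hx : x ∈ (extChartAt (𝓡 4) x₀).source)
    (l i j : Fin 4) :
    ∑ k, chartMetric G.val x₀ (extChartAt (𝓡 4) x₀ x) l k *
        G.christoffel x₀ (extChartAt (𝓡 4) x₀ x) k i j =
      (1 / 2) * (pderiv (fun z => chartMetric G.val x₀ z j l) (extChartAt (𝓡 4) x₀ x) i
      + pderiv (fun z => chartMetric G.val x₀ z i l) (extChartAt (𝓡 4) x₀ x) j
      - pderiv (fun z => chartMetric G.val x₀ z i j) (extChartAt (𝓡 4) x₀ x) l) := by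
  set y := extChartAt (𝓡 4) x₀ x
  set T : Fin 4 → ℝ := fun l => pderiv (fun z => chartMetric G.val x₀ z j l) y i
      + pderiv (fun z => chartMetric G.val x₀ z i l) y j
      - pderiv (fun z => chartMetric G.val x₀ z i j) y l with hT
  have h1 : ∀ k, G.christoffel x₀ y k i j = (1 / 2) * ((chartMetric G.val x₀ y)⁻¹ *ᵥ T) k :=
    fun k => rfl
  have h2 : chartMetric G.val x₀ y *ᵥ ((chartMetric G.val x₀ y)⁻¹ *ᵥ T) = T := by
    rw [Matrix.mulVec_mulVec, Matrix.mul_nonsing_inv _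
      ((Matrix.isUnit_iff_isUnit_det _).1 (G.isUnit_chartMetric hx)), Matrix.one_mulVec]
  have h3 := congrFun h2 l
  simp only [h1]
  change _ = (1 / 2) * T l
  rw [← h3]
  simp only [Matrix.mulVec, dotProduct, Finset.mul_sum]
  refine Finset.sum_congr rfl fun k _ => Finset.sum_congr rfl fun j _ => ?_
  ring

omit [IsManifold (𝓡 4) ∞ N] in
theorem christoffel_symm (x₀ : N) (y : Eu 4) (k i j : Fin 4) :
    G.christoffel x₀ y k i j = G.christoffel x₀ y k j i := by
  unfold christoffel
  congr 1
  refine Finset.sum_congr rfl fun l _ => ?_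
  have : (fun z => chartMetric G.val x₀ z i j) = fun z => chartMetric G.val x₀ z j i :=
    funext fun z => G.chartMetric_symm x₀ z i j
  rw [this]; ring

omit [IsManifold (𝓡 4) ∞ N] in
theorem differentiableAt_chartMetric {x₀ x : N} (hx : x ∈ (extChartAt (𝓡 4) x₀).source)
    (i j : Fin 4) :
    DifferentiableAt ℝ (fun z => chartMetric G.val x₀ z i j) (extChartAt (𝓡 4) x₀ x) :=
  ((G.smooth x₀ i j).contDiffAt ((isOpen_extChartAt_target x₀).mem_nhds
    ((extChartAt (𝓡 4) x₀).map_source hx))).differentiableAt (by simp)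

end LorentzMetric
end Spacetime

/-- The index computation behind `∇g = 0`, with `P` the velocity, `D m i j` standing for `∂ₘgᵢⱼ` and
`C` for the Christoffel symbols. Once the upper index is lowered by `hC`, the two Christoffel
contributions are `½(D m i j + D i m j - D j m i)` and `½(D m j i + D j m i - D i m j)`, which add
up to `D m i j`. -/
theorem metric_compatibility_algebra {ι : Type*} [Fintype ι] (g : ι → ι → ℝ)
    (D C : ι → ι → ι → ℝ) (P v w v' w' : ι → ℝ) (hg : ∀ i j, g i j = g j i)
    (hD : ∀ m i j, D m i j = D m j i)
    (hC : ∀ l i j, ∑ k, g l k * C k i j = 1 / 2 * (D i j l + D j i l - D l i j)) :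
    ∑ i, ∑ j, ((∑ m, P m * D m i j) * v i * w j + g i j * v' i * w j + g i j * v i * w' j) =
      ∑ i, ∑ j, g i j * (v' i + ∑ m, ∑ n, C i m n * P m * v n) * w j +
      ∑ i, ∑ j, g i j * v i * (w' j + ∑ m, ∑ n, C j m n * P m * w n) := by
  have key : ∀ (x : ι → ℝ) (j : ι), ∑ i, g j i * ∑ m, ∑ n, C i m n * P m * x n =
      ∑ m, ∑ n, 1 / 2 * (D m n j + D n m j - D j m n) * (P m * x n) := by
    intro x j
    simp only [← hC, Finset.mul_sum, Finset.sum_mul]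
    rw [Finset.sum_comm]
    refine Finset.sum_congr rfl fun m _ => ?_
    rw [Finset.sum_comm]
    refine Finset.sum_congr rfl fun n _ => Finset.sum_congr rfl fun i _ => ?_
    ring
  have e1 : ∑ i, ∑ j, g i j * (∑ m, ∑ n, C i m n * P m * v n) * w j =
      ∑ m, ∑ i, ∑ j, 1 / 2 * (D m i j + D i m j - D j m i) * (P m * v i) * w j := by
    rw [Finset.sum_comm]
    have : ∀ j, ∑ i, g i j * (∑ m, ∑ n, C i m n * P m * v n) * w j =
        ∑ m, ∑ n, 1 / 2 * (D m n j + D n m j - D j m n) * (P m * v n) * w j := fun j => by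
      rw [← Finset.sum_mul]
      simp only [hg _ j, key, Finset.sum_mul]
    simp only [this]
    rw [Finset.sum_comm]
    exact Finset.sum_congr rfl fun m _ => Finset.sum_comm
  have e2 : ∑ i, ∑ j, g i j * v i * (∑ m, ∑ n, C j m n * P m * w n) =
      ∑ m, ∑ i, ∑ j, 1 / 2 * (D m j i + D j m i - D i m j) * (P m * w j) * v i := by
    have : ∀ i, ∑ j, g i j * v i * (∑ m, ∑ n, C j m n * P m * w n) =
        ∑ m, ∑ n, 1 / 2 * (D m n i + D n m i - D i m n) * (P m * w n) * v i := fun i => by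
      have : ∀ j, g i j * v i * (∑ m, ∑ n, C j m n * P m * w n) =
        g i j * (∑ m, ∑ n, C j m n * P m * w n) * v i := fun j => by ring
      simp only [this, ← Finset.sum_mul]
      rw [key]
    simp only [this]
    rw [Finset.sum_comm]
  have e3 : ∑ i, ∑ j, (∑ m, P m * D m i j) * v i * w j =
      ∑ m, ∑ i, ∑ j, P m * D m i j * v i * w j := by
    simp only [Finset.sum_mul]
    rw [Finset.sum_comm' (t' := Finset.univ) (s' := fun _ => Finset.univ) (by simp)]
    have : ∀ j, ∑ i, ∑ m, P m * D m i j * v i * w j = ∑ m, ∑ i, P m * D m i j * v i * w j :=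
      fun j => Finset.sum_comm
    simp only [this]
    rw [Finset.sum_comm]
    exact Finset.sum_congr rfl fun m _ => Finset.sum_comm
  simp only [mul_add, add_mul, Finset.sum_add_distrib]
  rw [e1, e2, e3]
  have : ∑ m, ∑ i, ∑ j, P m * D m i j * v i * w j =
      ∑ m, ∑ i, ∑ j, 1 / 2 * (D m i j + D i m j - D j m i) * (P m * v i) * w j +
      ∑ m, ∑ i, ∑ j, 1 / 2 * (D m j i + D j m i - D i m j) * (P m * w j) * v i := by
    simp only [← Finset.sum_add_distrib]
    refine Finset.sum_congr rfl fun m _ => Finset.sum_congr rfl fun i _ =>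
      Finset.sum_congr rfl fun j _ => ?_
    rw [hD m j i]; ring
  rw [this]; ring

/-! ### The Levi-Civita derivative of fields along a map -/

section Spacetime

variable {N : Type*} [TopologicalSpace N] [ChartedSpace (Eu 4) N]

/-- `V` is a vector field along `Φ` which is differentiable at `q` in the chart around `Φ q`. -/
structure DifferentiableAlong {m : ℕ} (Φ : Eu m → N) (V : ∀ q, TangentSpace (𝓡 4) (Φ q))
    (q : Eu m) : Prop where
  continuousAt : ContinuousAt Φ q
  base : DifferentiableAt ℝ (fun q' => extChartAt (𝓡 4) (Φ q) (Φ q')) q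
  field : DifferentiableAt ℝ (fun q' => chartCoord (Φ q) (Φ q') (V q')) q

section Along

variable {m l : ℕ} {Φ : Eu m → N} {V V' : ∀ q, TangentSpace (𝓡 4) (Φ q)} {q : Eu m}

theorem DifferentiableAlong.eventually_mem_source (hV : DifferentiableAlong Φ V q) :
    ∀ᶠ q' in 𝓝 q, Φ q' ∈ (extChartAt (𝓡 4) (Φ q)).source :=
  hV.continuousAt (extChartAt_source_mem_nhds (Φ q))

theorem DifferentiableAlong.add (hV : DifferentiableAlong Φ V q)
    (hV' : DifferentiableAlong Φ V' q) : DifferentiableAlong Φ (fun q' => V q' + V' q') q :=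
  ⟨hV.continuousAt, hV.base, by simp only [map_add]; exact hV.field.add hV'.field⟩

theorem DifferentiableAlong.smul {f : Eu m → ℝ} (hf : DifferentiableAt ℝ f q)
    (hV : DifferentiableAlong Φ V q) : DifferentiableAlong Φ (fun q' => f q' • V q') q :=
  ⟨hV.continuousAt, hV.base, by simp only [map_smul]; exact hf.smul hV.field⟩

theorem DifferentiableAlong.sum {ι : Type*} {s : Finset ι}
    {V : ι → ∀ q, TangentSpace (𝓡 4) (Φ q)} (hΦ : ContinuousAt Φ q)
    (hb : DifferentiableAt ℝ (fun q' => extChartAt (𝓡 4) (Φ q) (Φ q')) q)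
    (hV : ∀ i ∈ s, DifferentiableAlong Φ (V i) q) :
    DifferentiableAlong Φ (fun q' => ∑ i ∈ s, V i q') q :=
  ⟨hΦ, hb, by
    simp only [map_sum]; exact DifferentiableAt.fun_sum fun i hi => (hV i hi).field⟩

theorem DifferentiableAlong.congr (hV : DifferentiableAlong Φ V q) (h : V' =ᶠ[𝓝 q] V) :
    DifferentiableAlong Φ V' q :=
  ⟨hV.continuousAt, hV.base, hV.field.congr_of_eventuallyEq (h.mono fun q' hq' => by
    simp only [hq'])⟩

theorem DifferentiableAlong.comp {f : Eu l → Eu m} {p : Eu l}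
    (hV : DifferentiableAlong Φ V (f p)) (hf : DifferentiableAt ℝ f p) :
    DifferentiableAlong (fun p' => Φ (f p')) (fun p' => V (f p')) p :=
  ⟨ContinuousAt.comp (f := f) hV.continuousAt hf.continuousAt, hV.base.comp p hf,
    DifferentiableAt.comp (f := f)
      (g := fun q' => chartCoord (Φ (f p)) (Φ q') (V q')) p hV.field hf⟩

end Along

variable [IsManifold (𝓡 4) ∞ N]

omit [IsManifold (𝓡 4) ∞ N] in
theorem contDiffAt_extChartAt_comp {m : ℕ} {Φ : Eu m → N} {q : Eu m}
    (hΦ : ContMDiffAt (𝓡 m) (𝓡 4) ∞ Φ q) :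
    ContDiffAt ℝ ∞ (fun q' => extChartAt (𝓡 4) (Φ q) (Φ q')) q := by
  rw [← contMDiffAt_iff_contDiffAt]
  exact (contMDiffAt_extChartAt (n := ∞)).comp q hΦ

theorem chartCoord_coordVec {m : ℕ} {Φ : Eu m → N} {q : Eu m} {x₀ : N}
    (hΦ : MDifferentiableAt (𝓡 m) (𝓡 4) Φ q) (hq : Φ q ∈ (extChartAt (𝓡 4) x₀).source)
    (b : Fin m) :
    chartCoord x₀ (Φ q) (coordVec Φ q b) =
      pderiv (fun q' => extChartAt (𝓡 4) x₀ (Φ q')) q b := by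
  have h := mfderiv_comp q (mdifferentiableAt_extChartAt (I := 𝓡 4) (x := x₀) (y := Φ q)
    (by rwa [extChartAt_source] at hq)) hΦ
  rw [mfderiv_eq_fderiv] at h
  exact (DFunLike.congr_fun h (stdVec b)).symm

/-- The chart stays the one around `Φ q` while `q'` varies, so this equality of germs can be
differentiated at `q`. -/
theorem eventually_chartCoord_coordVec {m : ℕ} {Φ : Eu m → N} {q : Eu m}
    (hΦ : ContMDiffAt (𝓡 m) (𝓡 4) ∞ Φ q) (b : Fin m) :
    (fun q' => chartCoord (Φ q) (Φ q') (coordVec Φ q' b)) =ᶠ[𝓝 q]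
      fun q' => pderiv (fun q' => extChartAt (𝓡 4) (Φ q) (Φ q')) q' b := by
  have h1 : ∀ᶠ q' in 𝓝 q, ContMDiffAt (𝓡 m) (𝓡 4) 1 Φ q' :=
    (contMDiffAt_iff_contMDiffAt_nhds (by simp)).1 (hΦ.of_le (by norm_cast))
  filter_upwards [h1, hΦ.continuousAt (extChartAt_source_mem_nhds (I := 𝓡 4) (Φ q))]
    with q' h1 h2
  exact chartCoord_coordVec (h1.mdifferentiableAt (by simp)) h2 b

theorem ContDiffAt.pderiv {m : ℕ} {E : Type*} [NormedAddCommGroup E] [NormedSpace ℝ E]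
    {f : Eu m → E} {q : Eu m} (hf : ContDiffAt ℝ ∞ f q) (i : Fin m) :
    ContDiffAt ℝ ∞ (fun q' => pderiv f q' i) q :=
  (hf.fderiv_right (m := ∞) (by simp)).clm_apply contDiffAt_const

theorem pderiv_pderiv_comm {m : ℕ} {E : Type*} [NormedAddCommGroup E] [NormedSpace ℝ E]
    {f : Eu m → E} {q : Eu m} (hf : ContDiffAt ℝ ∞ f q) (i j : Fin m) :
    pderiv (fun q' => pderiv f q' i) q j = pderiv (fun q' => pderiv f q' j) q i := by
  have hd : DifferentiableAt ℝ (fderiv ℝ f) q :=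
    (hf.fderiv_right (m := ∞) (by simp)).differentiableAt (by simp)
  have h : ∀ i j, pderiv (fun q' => pderiv f q' i) q j =
      fderiv ℝ (fderiv ℝ f) q (stdVec j) (stdVec i) := fun i j => by
    unfold _root_.pderiv
    rw [fderiv_clm_apply hd (differentiableAt_const _)]
    simp
  rw [h, h]
  exact (hf.isSymmSndFDerivAt (by simpa using ENat.LEInfty.out)).eq _ _

theorem differentiableAlong_coordVec {m : ℕ} {Φ : Eu m → N} {q : Eu m}
    (hΦ : ContMDiffAt (𝓡 m) (𝓡 4) ∞ Φ q) (b : Fin m) :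
    DifferentiableAlong Φ (fun q' => coordVec Φ q' b) q :=
  ⟨hΦ.continuousAt, (contDiffAt_extChartAt_comp hΦ).differentiableAt (by simp),
    (((contDiffAt_extChartAt_comp hΦ).pderiv b).differentiableAt (by simp)).congr_of_eventuallyEq
      (eventually_chartCoord_coordVec hΦ b)⟩

/-- Over the chart domain, the trivialization of the tangent bundle at `Φ q` is the derivative of
the chart, so bundle smoothness controls the chart components of `V`. -/
theorem differentiableAlong_of_contMDiffAt {m : ℕ} {Φ : Eu m → N}
    {V : ∀ q, TangentSpace (𝓡 4) (Φ q)} {q : Eu m}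
    (hV : ContMDiffAt (𝓡 m) (𝓡 4).tangent ∞
      (fun q' => (⟨Φ q', V q'⟩ : TangentBundle (𝓡 4) N)) q) :
    DifferentiableAlong Φ V q := by
  have h := Bundle.contMDiffAt_totalSpace.1 hV
  have hΦ : ContMDiffAt (𝓡 m) (𝓡 4) ∞ Φ q := h.1
  refine ⟨hΦ.continuousAt, (contDiffAt_extChartAt_comp hΦ).differentiableAt (by simp), ?_⟩
  have h2 := (contMDiffAt_iff_contDiffAt.1 h.2).differentiableAt (by simp)
  refine h2.congr_of_eventuallyEq ?_
  filter_upwards [hΦ.continuousAt (extChartAt_source_mem_nhds (I := 𝓡 4) (Φ q))] with q' hq'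
  rw [Set.mem_preimage, extChartAt_source] at hq'
  unfold chartCoord
  rw [← TangentBundle.continuousLinearMapAt_trivializationAt hq']
  rw [Bundle.Trivialization.continuousLinearMapAt_apply]
  have hb : Φ q' ∈ (trivializationAt (Eu 4) (TangentSpace (𝓡 4)) (Φ q)).baseSet := by
    rwa [TangentBundle.trivializationAt_baseSet]
  exact congrFun (Bundle.Trivialization.coe_linearMapAt_of_mem (R := ℝ) _ hb) (V q')

namespace LorentzMetric

variable (G : LorentzMetric N)

section Along

variable {m l : ℕ} {Φ : Eu m → N} {V V' : ∀ q, TangentSpace (𝓡 4) (Φ q)} {q : Eu m}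

theorem chartCoord_covDeriv (Φ : Eu m → N) (V : ∀ q, TangentSpace (𝓡 4) (Φ q)) (q : Eu m)
    (a : Fin m) (k : Fin 4) :
    chartCoord (Φ q) (Φ q) (G.covDeriv Φ V q a) k =
      pderiv (fun q' => chartCoord (Φ q) (Φ q') (V q')) q a k +
      ∑ i, ∑ j, G.christoffel (Φ q) (extChartAt (𝓡 4) (Φ q) (Φ q)) k i j *
        pderiv (fun q' => extChartAt (𝓡 4) (Φ q) (Φ q')) q a i *
        chartCoord (Φ q) (Φ q) (V q) j := by
  unfold covDeriv
  simp only [map_sum, map_smul, chartCoord_inverse (mem_extChartAt_source (Φ q))]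
  simp [stdVec, Pi.single_apply]
  rfl

theorem covDeriv_congr (h : V =ᶠ[𝓝 q] V') (a : Fin m) :
    G.covDeriv Φ V q a = G.covDeriv Φ V' q a := by
  refine chartCoord_injective (mem_extChartAt_source (Φ q)) ?_
  ext k
  have : pderiv (fun q' => chartCoord (Φ q) (Φ q') (V q')) q =
      pderiv (fun q' => chartCoord (Φ q) (Φ q') (V' q')) q := by
    unfold pderiv
    rw [Filter.EventuallyEq.fderiv_eq (h.mono fun q' hq' =>
      congrArg (chartCoord (Φ q) (Φ q')) hq')]
  rw [chartCoord_covDeriv, chartCoord_covDeriv, this, h.self_of_nhds]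

theorem covDeriv_add (hV : DifferentiableAlong Φ V q) (hV' : DifferentiableAlong Φ V' q)
    (a : Fin m) : G.covDeriv Φ (fun q' => V q' + V' q') q a =
      G.covDeriv Φ V q a + G.covDeriv Φ V' q a := by
  refine chartCoord_injective (mem_extChartAt_source (Φ q)) ?_
  ext k
  have : pderiv (fun q' => chartCoord (Φ q) (Φ q') (V q' + V' q')) q a =
      pderiv (fun q' => chartCoord (Φ q) (Φ q') (V q')) q a +
      pderiv (fun q' => chartCoord (Φ q) (Φ q') (V' q')) q a := by
    unfold pderiv
    simp only [map_add]
    rw [fderiv_fun_add hV.field hV'.field]; rfl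
  rw [chartCoord_covDeriv, this]
  simp only [map_add, PiLp.add_apply, chartCoord_covDeriv, mul_add, Finset.sum_add_distrib]
  ring

theorem covDeriv_smul {f : Eu m → ℝ} (hf : DifferentiableAt ℝ f q)
    (hV : DifferentiableAlong Φ V q) (a : Fin m) :
    G.covDeriv Φ (fun q' => f q' • V q') q a =
      pderiv f q a • V q + f q • G.covDeriv Φ V q a := by
  refine chartCoord_injective (mem_extChartAt_source (Φ q)) ?_
  ext k
  have : pderiv (fun q' => chartCoord (Φ q) (Φ q') (f q' • V q')) q a =
      f q • pderiv (fun q' => chartCoord (Φ q) (Φ q') (V q')) q a +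
      pderiv f q a • chartCoord (Φ q) (Φ q) (V q) := by
    unfold pderiv
    simp only [map_smul]
    rw [fderiv_fun_smul hf hV.field]; rfl
  rw [chartCoord_covDeriv, this]
  simp only [map_add, map_smul, PiLp.add_apply, PiLp.smul_apply, smul_eq_mul, chartCoord_covDeriv,
    mul_add, Finset.mul_sum]
  simp only [mul_left_comm _ (f q)]
  ring

theorem covDeriv_sum {ι : Type*} {s : Finset ι}
    {V : ι → ∀ q, TangentSpace (𝓡 4) (Φ q)} (hV : ∀ i ∈ s, DifferentiableAlong Φ (V i) q)
    (a : Fin m) : G.covDeriv Φ (fun q' => ∑ i ∈ s, V i q') q a =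
      ∑ i ∈ s, G.covDeriv Φ (V i) q a := by
  refine chartCoord_injective (mem_extChartAt_source (Φ q)) ?_
  ext k
  have : pderiv (fun q' => chartCoord (Φ q) (Φ q') (∑ i ∈ s, V i q')) q a =
      ∑ i ∈ s, pderiv (fun q' => chartCoord (Φ q) (Φ q') (V i q')) q a := by
    unfold pderiv
    simp only [map_sum]
    rw [fderiv_fun_sum fun i hi => (hV i hi).field]
    simp
  rw [chartCoord_covDeriv, this]
  simp only [map_sum, WithLp.ofLp_sum, Finset.sum_apply, chartCoord_covDeriv,
    Finset.sum_add_distrib, Finset.mul_sum]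
  congr 1
  rw [Finset.sum_comm' (s := s) (t' := Finset.univ) (s' := fun _ => s) (by simp)]
  exact Finset.sum_congr rfl fun i _ => Finset.sum_comm

/-- Both sides use the chart around `Φ (f p)`, so only the Euclidean chain rule is needed. This
transfers derivatives along the hypersurface to derivatives along the sphere inside it. -/
theorem covDeriv_comp {f : Eu l → Eu m} {p : Eu l}
    (hV : DifferentiableAlong Φ V (f p)) (hf : DifferentiableAt ℝ f p) (a : Fin l) :
    G.covDeriv (fun p' => Φ (f p')) (fun p' => V (f p')) p a =
      ∑ i, pderiv f p a i • G.covDeriv Φ V (f p) i := by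
  refine chartCoord_injective (mem_extChartAt_source (Φ (f p))) ?_
  ext k
  have chain : ∀ h : Eu m → Eu 4, DifferentiableAt ℝ h (f p) →
      pderiv (fun p' => h (f p')) p a = ∑ i, pderiv f p a i • pderiv h (f p) i := fun h hh => by
    rw [pderiv, fderiv_fun_comp p hh hf]
    exact map_eq_sum_stdVec (fderiv ℝ h (f p)) (pderiv f p a)
  have h1 := chain _ hV.field
  have h2 := chain _ hV.base
  rw [G.chartCoord_covDeriv (fun p' => Φ (f p'))]
  rw [h1, h2]
  simp only [map_sum, map_smul, WithLp.ofLp_sum, WithLp.ofLp_smul, Finset.sum_apply, Pi.smul_apply, smul_eq_mul, chartCoord_covDeriv,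
    mul_add, Finset.sum_add_distrib, Finset.mul_sum, Finset.sum_mul]
  congr 1
  rw [Finset.sum_comm' (s := Finset.univ) (t := fun _ : Fin m => Finset.univ)
    (t' := Finset.univ) (s' := fun _ => Finset.univ) (by simp)]
  refine Finset.sum_congr rfl fun i _ => ?_
  rw [Finset.sum_comm]
  refine Finset.sum_congr rfl fun j _ => Finset.sum_congr rfl fun x _ => ?_
  ring

/-- The Levi-Civita connection is torsion-free. -/
theorem covDeriv_coordVec_comm (hΦ : ContMDiffAt (𝓡 m) (𝓡 4) ∞ Φ q) (a b : Fin m) :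
    G.covDeriv Φ (fun q' => coordVec Φ q' b) q a =
      G.covDeriv Φ (fun q' => coordVec Φ q' a) q b := by
  refine chartCoord_injective (mem_extChartAt_source (Φ q)) ?_
  ext k
  have h : ∀ a b, pderiv (fun q' => chartCoord (Φ q) (Φ q') (coordVec Φ q' b)) q a =
      pderiv (fun q' => pderiv (fun q' => extChartAt (𝓡 4) (Φ q) (Φ q')) q' b) q a :=
    fun a b => by
      unfold pderiv
      rw [(eventually_chartCoord_coordVec hΦ b).fderiv_eq]; rfl
  have h2 : ∀ b, chartCoord (Φ q) (Φ q) (coordVec Φ q b) =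
      pderiv (fun q' => extChartAt (𝓡 4) (Φ q) (Φ q')) q b :=
    fun b => (eventually_chartCoord_coordVec hΦ b).self_of_nhds
  rw [chartCoord_covDeriv, chartCoord_covDeriv, h, h, h2, h2,
    pderiv_pderiv_comm (contDiffAt_extChartAt_comp hΦ), Finset.sum_comm]
  congr 1
  refine Finset.sum_congr rfl fun i _ => Finset.sum_congr rfl fun j _ => ?_
  rw [G.christoffel_symm]; ring

/-- The Levi-Civita connection is compatible with the metric. -/
theorem pderiv_val (hV : DifferentiableAlong Φ V q) (hV' : DifferentiableAlong Φ V' q) :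
    ∀ a, pderiv (fun q' => G.val (Φ q') (V q') (V' q')) q a =
      G.val (Φ q) (G.covDeriv Φ V q a) (V' q) + G.val (Φ q) (V q) (G.covDeriv Φ V' q a) := by
  set φ := extChartAt (𝓡 4) (Φ q) with hφ
  have hsrc := mem_extChartAt_source (I := 𝓡 4) (Φ q)
  have hev : (fun q' => G.val (Φ q') (V q') (V' q')) =ᶠ[𝓝 q] fun q' =>
      ∑ i, ∑ j, chartMetric G.val (Φ q) (φ (Φ q')) i j *
      chartCoord (Φ q) (Φ q') (V q') i * chartCoord (Φ q) (Φ q') (V' q') j := by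
    filter_upwards [hV.eventually_mem_source] with q' hq'
    exact G.val_eq_sum_chartMetric hq' _ _
  have hterm : ∀ i j, HasFDerivAt (fun q' => chartMetric G.val (Φ q) (φ (Φ q')) i j *
      chartCoord (Φ q) (Φ q') (V q') i * chartCoord (Φ q) (Φ q') (V' q') j) _ q := fun i j =>
    (((G.differentiableAt_chartMetric hsrc i j).hasFDerivAt.comp q hV.base.hasFDerivAt).mul
      (hasFDerivAt_eu_apply hV.field.hasFDerivAt i)).mul
      (hasFDerivAt_eu_apply hV'.field.hasFDerivAt j)
  have hsum := HasFDerivAt.fun_sum (u := Finset.univ) fun i _ =>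
    HasFDerivAt.fun_sum (u := Finset.univ) fun j _ => hterm i j
  intro a
  rw [pderiv, hev.fderiv_eq, hsum.fderiv, G.val_eq_sum_chartMetric hsrc,
    G.val_eq_sum_chartMetric hsrc]
  simp only [chartCoord_covDeriv]
  -- The product rule for the component expression matches the left side of the algebraic identity,
  -- with `P = ∂ₐΦ` in the chart and `D` the partial derivatives of the metric components.
  rw [← metric_compatibility_algebra (D := fun m i j =>
      pderiv (fun z => chartMetric G.val (Φ q) z i j) (φ (Φ q)) m)
    (hg := fun i j => G.chartMetric_symm _ _ i j)
    (hD := fun m i j => by simp only [G.chartMetric_symm _ _ i j])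
    (hC := fun l i j => G.sum_chartMetric_mul_christoffel hsrc l i j)]
  simp only [sum_apply]
  refine Finset.sum_congr rfl fun i _ => Finset.sum_congr rfl fun j _ => ?_
  simp only [add_apply, smul_apply,
    ContinuousLinearMap.comp_apply, smul_eq_mul, Pi.mul_apply]
  rw [map_eq_sum_stdVec (fderiv ℝ (fun z => chartMetric G.val (Φ q) z i j) (φ (Φ q)))]
  simp only [smul_eq_mul, pderiv, PiLp.proj_apply]
  ring

end Along

end LorentzMetric
end Spacetime

/-! ### Normal frames and the connection form in mean curvature gauge -/

section Spacetime

variable {N : Type*} [TopologicalSpace N] [ChartedSpace (Eu 4) N]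

theorem pderiv_eq_zero_of_eventually_const {m : ℕ} {f : Eu m → ℝ} {q : Eu m} {c : ℝ}
    (h : ∀ᶠ q' in 𝓝 q, f q' = c) (a : Fin m) : pderiv f q a = 0 := by
  have : f =ᶠ[𝓝 q] fun _ => c := h
  rw [pderiv, this.fderiv_eq]
  simp

namespace LorentzMetric

variable (G : LorentzMetric N)

theorem normalPart_eq {m : ℕ} (Φ : Eu m → N) (q : Eu m) (v : TangentSpace (𝓡 4) (Φ q)) :
    G.normalPart Φ q v = v - ∑ a, ∑ b,
      ((G.inducedMetric Φ q)⁻¹ a b * G.val (Φ q) v (coordVec Φ q a)) • coordVec Φ q b := rfl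

theorem val_normalPart_coordVec {m : ℕ} {Φ : Eu m → N} {q : Eu m}
    (hσ : IsUnit (G.inducedMetric Φ q).det) (v : TangentSpace (𝓡 4) (Φ q)) (c : Fin m) :
    G.val (Φ q) (G.normalPart Φ q v) (coordVec Φ q c) = 0 := by
  have h := Matrix.mul_nonsing_inv _ hσ
  rw [normalPart_eq]
  simp only [map_sub, map_sum, LinearMap.sub_apply, LinearMap.sum_apply, map_smul,
    LinearMap.smul_apply, smul_eq_mul]
  have h2 : ∀ a, ∑ b, (G.inducedMetric Φ q)⁻¹ a b * G.val (Φ q) v (coordVec Φ q a) *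
      G.val (Φ q) (coordVec Φ q b) (coordVec Φ q c) =
      (if a = c then 1 else 0) * G.val (Φ q) v (coordVec Φ q a) := fun a => by
    have h3 := congrFun (congrFun (Matrix.nonsing_inv_mul _ hσ) a) c
    rw [Matrix.mul_apply, Matrix.one_apply] at h3
    rw [← h3, Finset.sum_mul]
    refine Finset.sum_congr rfl fun b _ => ?_
    simp only [inducedMetric, Matrix.of_apply]; ring
  simp [h2]

theorem val_normalPart_of_orthogonal {m : ℕ} {Φ : Eu m → N} {q : Eu m}
    (v : TangentSpace (𝓡 4) (Φ q)) {e : TangentSpace (𝓡 4) (Φ q)}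
    (he : ∀ a, G.val (Φ q) e (coordVec Φ q a) = 0) :
    G.val (Φ q) (G.normalPart Φ q v) e = G.val (Φ q) v e := by
  have he' : ∀ a, G.val (Φ q) (coordVec Φ q a) e = 0 := fun a => by rw [G.symm, he]
  rw [normalPart_eq]
  simp [he']

/-- `e₃, e₄` is an orthonormal frame of the normal space of `Φ` at `q`, with `e₃` spacelike and
`e₄` timelike. -/
structure IsNormalFrame (Φ : Eu 2 → N) (q : Eu 2) (e₃ e₄ : TangentSpace (𝓡 4) (Φ q)) : Prop where
  isUnit_det : IsUnit (G.inducedMetric Φ q).det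
  unit_three : G.val (Φ q) e₃ e₃ = 1
  unit_four : G.val (Φ q) e₄ e₄ = -1
  orthogonal : G.val (Φ q) e₃ e₄ = 0
  normal_three : ∀ a, G.val (Φ q) e₃ (coordVec Φ q a) = 0
  normal_four : ∀ a, G.val (Φ q) e₄ (coordVec Φ q a) = 0

namespace IsNormalFrame

variable {G} {Φ : Eu 2 → N} {q : Eu 2} {e₃ e₄ : TangentSpace (𝓡 4) (Φ q)}

/-- The frame together with the two coordinate vectors is linearly independent, hence spans the
4-dimensional tangent space; nondegeneracy of the metric does the rest. -/
theorem eq_zero_of_orthogonal (he : G.IsNormalFrame Φ q e₃ e₄) {w : TangentSpace (𝓡 4) (Φ q)}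
    (h3 : G.val (Φ q) w e₃ = 0) (h4 : G.val (Φ q) w e₄ = 0)
    (hΦ : ∀ a, G.val (Φ q) w (coordVec Φ q a) = 0) : w = 0 := by
  obtain ⟨b, -⟩ := G.signature (Φ q)
  have := Module.Finite.of_basis b
  have hli : LinearIndependent ℝ ![e₃, e₄, coordVec Φ q 0, coordVec Φ q 1] := by
    rw [Fintype.linearIndependent_iff]
    intro c hc
    simp only [Fin.sum_univ_four, Matrix.cons_val_zero, Matrix.cons_val_one,
      Matrix.cons_val] at hc
    have pair : ∀ v, c 0 * G.val (Φ q) e₃ v + c 1 * G.val (Φ q) e₄ v +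
        c 2 * G.val (Φ q) (coordVec Φ q 0) v + c 3 * G.val (Φ q) (coordVec Φ q 1) v = 0 :=
      fun v => by
        have := congrArg (fun z => G.val (Φ q) z v) hc
        simpa using this
    have h30 : ∀ a, G.val (Φ q) (coordVec Φ q a) e₃ = 0 := fun a => by
      rw [G.symm, he.normal_three]
    have h40 : ∀ a, G.val (Φ q) (coordVec Φ q a) e₄ = 0 := fun a => by
      rw [G.symm, he.normal_four]
    have c0 : c 0 = 0 := by
      have := pair e₃
      rw [he.unit_three, G.symm _ e₄ e₃, he.orthogonal, h30, h30] at this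
      linarith
    have c1 : c 1 = 0 := by
      have := pair e₄
      rw [he.unit_four, he.orthogonal, h40, h40] at this
      linarith
    -- Pairing the relation with each `∂ₐ` shows that this row vector is annihilated by the
    -- invertible induced metric.
    have c23 : ![c 2, c 3] = 0 := by
      refine Matrix.eq_zero_of_vecMul_eq_zero he.isUnit_det.ne_zero ?_
      funext a
      have := pair (coordVec Φ q a)
      rw [c0, c1] at this
      simpa [Matrix.vecMul, dotProduct, Fin.sum_univ_two, inducedMetric] using this
    have c2 := congrFun c23 0
    have c3 := congrFun c23 1
    intro i
    fin_cases i
    · exact c0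
    · exact c1
    · exact c2
    · exact c3
  have hcard : Fintype.card (Fin 4) = Module.finrank ℝ (TangentSpace (𝓡 4) (Φ q)) :=
    (Module.finrank_eq_card_basis b).symm
  refine G.eq_zero_of_forall_val_eq_zero fun v => ?_
  have hspan := hli.span_eq_top_of_card_eq_finrank' hcard
  have hle : Submodule.span ℝ (Set.range ![e₃, e₄, coordVec Φ q 0, coordVec Φ q 1]) ≤
      LinearMap.ker (G.val (Φ q) w) := by
    rw [Submodule.span_le]
    rintro _ ⟨i, rfl⟩
    fin_cases i
    · exact h3
    · exact h4
    · exact hΦ 0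
    · exact hΦ 1
  exact hle (hspan ▸ Submodule.mem_top : v ∈ _)

/-- The two sides have the same pairings with `e₃`, `e₄` and the coordinate vectors; the minus sign
reflects `⟨e₄, e₄⟩ = -1`. -/
theorem normalPart_eq (he : G.IsNormalFrame Φ q e₃ e₄) (v : TangentSpace (𝓡 4) (Φ q)) :
    G.normalPart Φ q v = G.val (Φ q) v e₃ • e₃ - G.val (Φ q) v e₄ • e₄ := by
  refine sub_eq_zero.1 (he.eq_zero_of_orthogonal ?_ ?_ fun a => ?_)
  · simp only [map_sub, LinearMap.sub_apply, map_smul, LinearMap.smul_apply, smul_eq_mul,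
      G.val_normalPart_of_orthogonal v he.normal_three, he.unit_three, G.symm _ e₄ e₃,
      he.orthogonal]
    ring
  · simp only [map_sub, LinearMap.sub_apply, map_smul, LinearMap.smul_apply, smul_eq_mul,
      G.val_normalPart_of_orthogonal v he.normal_four, he.unit_four, he.orthogonal]
    ring
  · simp only [map_sub, LinearMap.sub_apply, map_smul, LinearMap.smul_apply, smul_eq_mul,
      G.val_normalPart_coordVec he.isUnit_det, he.normal_three, he.normal_four]
    ring

theorem meanCurvature_eq (he : G.IsNormalFrame Φ q e₃ e₄) :
    G.meanCurvature Φ q =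
      (∑ a, ∑ b, (G.inducedMetric Φ q)⁻¹ a b *
        G.val (Φ q) (G.covDeriv Φ (fun q' => coordVec Φ q' b) q a) e₃) • e₃ -
      (∑ a, ∑ b, (G.inducedMetric Φ q)⁻¹ a b *
        G.val (Φ q) (G.covDeriv Φ (fun q' => coordVec Φ q' b) q a) e₄) • e₄ := by
  unfold meanCurvature
  simp only [he.normalPart_eq, smul_sub, smul_smul, Finset.sum_sub_distrib, Finset.sum_smul]

/-- Since `⟨e₄ + e₃, e₄ - e₃⟩ = -2`, the subtracted multiple of `e₄ + e₃` is `α + β`: the reflection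
swaps the two coefficients and changes their signs. -/
theorem reflectIncoming_eq (he : G.IsNormalFrame Φ q e₃ e₄) (α β : ℝ) :
    G.reflectIncoming e₃ e₄ (α • e₃ + β • e₄) = (-α) • e₄ + (-β) • e₃ := by
  unfold reflectIncoming
  have h : 2 * G.val (Φ q) (α • e₃ + β • e₄) (e₄ - e₃) / G.val (Φ q) (e₄ + e₃) (e₄ - e₃) =
      α + β := by
    simp only [map_add, map_sub, LinearMap.add_apply, map_smul, LinearMap.smul_apply, smul_eq_mul,
      he.unit_three, he.unit_four, he.orthogonal, G.symm _ e₄ e₃]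
    ring
  rw [h]
  module

theorem val_combination (he : G.IsNormalFrame Φ q e₃ e₄) (α β : ℝ) :
    G.val (Φ q) (α • e₃ + β • e₄) (α • e₃ + β • e₄) = α ^ 2 - β ^ 2 := by
  simp only [map_add, LinearMap.add_apply, map_smul, LinearMap.smul_apply, smul_eq_mul,
    he.unit_three, he.unit_four, he.orthogonal, G.symm _ e₄ e₃]
  ring

end IsNormalFrame

variable [IsManifold (𝓡 4) ∞ N]

section Along

variable {m : ℕ} {Φ : Eu m → N} {V V' : ∀ q, TangentSpace (𝓡 4) (Φ q)} {q : Eu m}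

theorem val_covDeriv_eq_neg (hV : DifferentiableAlong Φ V q) (hV' : DifferentiableAlong Φ V' q)
    {c : ℝ} (h : ∀ᶠ q' in 𝓝 q, G.val (Φ q') (V q') (V' q') = c) (a : Fin m) :
    G.val (Φ q) (G.covDeriv Φ V q a) (V' q) = -G.val (Φ q) (G.covDeriv Φ V' q a) (V q) := by
  have h1 := G.pderiv_val hV hV' a
  rw [pderiv_eq_zero_of_eventually_const h] at h1
  rw [G.symm _ (V q)] at h1
  linarith

/-- Koszul's formula for coordinate vector fields. -/
theorem val_covDeriv_coordVec (hΦ : ContMDiffAt (𝓡 m) (𝓡 4) ∞ Φ q) (i j k : Fin m) :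
    G.val (Φ q) (G.covDeriv Φ (fun q' => coordVec Φ q' j) q i) (coordVec Φ q k) =
      1 / 2 * (pderiv (fun q' => G.inducedMetric Φ q' j k) q i
        + pderiv (fun q' => G.inducedMetric Φ q' i k) q j
        - pderiv (fun q' => G.inducedMetric Φ q' i j) q k) := by
  have h : ∀ i j k, pderiv (fun q' => G.inducedMetric Φ q' j k) q i =
      G.val (Φ q) (G.covDeriv Φ (fun q' => coordVec Φ q' j) q i) (coordVec Φ q k) +
      G.val (Φ q) (G.covDeriv Φ (fun q' => coordVec Φ q' k) q i) (coordVec Φ q j) :=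
    fun i j k => by
      have := G.pderiv_val (differentiableAlong_coordVec hΦ j)
        (differentiableAlong_coordVec hΦ k) i
      rw [G.symm _ (coordVec Φ q j)] at this
      exact this
  rw [h, h, h, G.covDeriv_coordVec_comm hΦ j i, G.covDeriv_coordVec_comm hΦ k i,
    G.covDeriv_coordVec_comm hΦ k j]
  ring

/-- By compatibility the form equals `-⟨∇ᵢ∂ⱼ, n⟩`, which is symmetric because the connection is
torsion-free. -/
theorem secondFundamentalForm_symm {n : ∀ q, TangentSpace (𝓡 4) (Φ q)}
    (hΦ : ContMDiffAt (𝓡 m) (𝓡 4) ∞ Φ q) (hn : DifferentiableAlong Φ n q)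
    (h : ∀ᶠ q' in 𝓝 q, ∀ i, G.val (Φ q') (n q') (coordVec Φ q' i) = 0) (i j : Fin m) :
    G.secondFundamentalForm Φ n q i j = G.secondFundamentalForm Φ n q j i := by
  have key : ∀ i j, G.secondFundamentalForm Φ n q i j =
      -G.val (Φ q) (G.covDeriv Φ (fun q' => coordVec Φ q' j) q i) (n q) := fun i j =>
    G.val_covDeriv_eq_neg hn (differentiableAlong_coordVec hΦ j) (h.mono fun q' h => h j) i
  rw [key, key, G.covDeriv_coordVec_comm hΦ]

end Along

/-- The connection form of the normal bundle, when the mean curvature vector is `-h e₃ + p e₄`. -/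
theorem connectionForm_eq {Φ : Eu 2 → N} {e₃ e₄ : ∀ q, TangentSpace (𝓡 4) (Φ q)} {q : Eu 2}
    {h p : Eu 2 → ℝ} (hframe : ∀ᶠ q' in 𝓝 q, G.IsNormalFrame Φ q' (e₃ q') (e₄ q'))
    (hH : ∀ᶠ q' in 𝓝 q, G.meanCurvature Φ q' = (-h q') • e₃ q' + p q' • e₄ q')
    (hh : DifferentiableAt ℝ h q) (hp : DifferentiableAt ℝ p q)
    (h₃ : DifferentiableAlong Φ e₃ q) (h₄ : DifferentiableAlong Φ e₄ q)
    (hpos : 0 < h q ^ 2 - p q ^ 2) (a : Fin 2) :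
    G.connectionForm Φ e₃ e₄ q a =
      (h q * pderiv p q a - p q * pderiv h q a) / (h q ^ 2 - p q ^ 2) -
        G.val (Φ q) (G.covDeriv Φ e₄ q a) (e₃ q) := by
  have he := hframe.self_of_nhds
  have hnorm : ∀ᶠ q' in 𝓝 q, G.meanCurvatureNorm Φ q' = Real.sqrt (h q' ^ 2 - p q' ^ 2) := by
    filter_upwards [hframe, hH] with q' he' hH'
    rw [meanCurvatureNorm, meanCurvatureSq, hH', he'.val_combination, neg_sq]
  -- The factor `w` is `1/|H|` near `q`. Its derivative will appear in `pc` and `ps` but cancels in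
  -- the final pairing, since `J` is orthogonal to `H`.
  set w : Eu 2 → ℝ := fun q' => (Real.sqrt (h q' ^ 2 - p q' ^ 2))⁻¹ with hw
  have hwd : DifferentiableAt ℝ w q :=
    (((hh.pow 2).sub (hp.pow 2)).sqrt hpos.ne').inv (Real.sqrt_pos.2 hpos).ne'
  have hw2 : w q ^ 2 = (h q ^ 2 - p q ^ 2)⁻¹ := by
    simp only [hw]; rw [inv_pow, Real.sq_sqrt hpos.le]
  have hJ : (fun q' => (G.meanCurvatureNorm Φ q')⁻¹ •
      G.reflectIncoming (e₃ q') (e₄ q') (G.meanCurvature Φ q')) =ᶠ[𝓝 q]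
      fun q' => (w q' * h q') • e₄ q' + (-(w q' * p q')) • e₃ q' := by
    filter_upwards [hframe, hH, hnorm] with q' he' hH' hn'
    rw [hn', hH', he'.reflectIncoming_eq]
    change w q' • ((- -h q') • e₄ q' + (-p q') • e₃ q') = _
    rw [smul_add, smul_smul, smul_smul, neg_neg, mul_neg]
  have dc : DifferentiableAt ℝ (fun q' => w q' * h q') q := hwd.mul hh
  have ds : DifferentiableAt ℝ (fun q' => -(w q' * p q')) q := (hwd.mul hp).neg
  have pc : pderiv (fun q' => w q' * h q') q a = w q * pderiv h q a + h q * pderiv w q a := by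
    unfold pderiv; rw [fderiv_fun_mul hwd hh]; rfl
  have ps : pderiv (fun q' => -(w q' * p q')) q a =
      -(w q * pderiv p q a + p q * pderiv w q a) := by
    unfold pderiv; rw [fderiv_fun_neg, fderiv_fun_mul hwd hp]; rfl
  have k1 : G.val (Φ q) (G.covDeriv Φ e₄ q a) (e₄ q) = 0 := by
    have := G.val_covDeriv_eq_neg h₄ h₄ (hframe.mono fun q' h => h.unit_four) a
    linarith
  have k2 : G.val (Φ q) (G.covDeriv Φ e₃ q a) (e₃ q) = 0 := by
    have := G.val_covDeriv_eq_neg h₃ h₃ (hframe.mono fun q' h => h.unit_three) a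
    linarith
  have k3 := G.val_covDeriv_eq_neg h₃ h₄ (hframe.mono fun q' h => h.orthogonal) a
  rw [connectionForm, normalConnection, hnorm.self_of_nhds, hH.self_of_nhds,
    G.covDeriv_congr hJ, G.covDeriv_add (h₄.smul dc) (h₃.smul ds), G.covDeriv_smul dc h₄,
    G.covDeriv_smul ds h₃, he.normalPart_eq, pc, ps]
  change G.val (Φ q) _ (w q • _) = _
  simp only [map_add, map_sub, LinearMap.add_apply, LinearMap.sub_apply, map_smul,
    LinearMap.smul_apply, smul_eq_mul, he.unit_three, he.unit_four, he.orthogonal,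
    G.symm _ (e₄ q) (e₃ q), k1, k2, k3]
  rw [div_eq_mul_inv, ← hw2]
  have hw3 : w q ^ 2 * (h q ^ 2 - p q ^ 2) = 1 := by rw [hw2, inv_mul_cancel₀ hpos.ne']
  -- The frame derivatives enter as `-w²(h² - p²)⟨∇ₐe₄, e₃⟩`, because `⟨∇ₐe₃, e₄⟩ = -⟨∇ₐe₄, e₃⟩`;
  -- the normalization of `w` removes the factor.
  linear_combination (-G.val (Φ q) (G.covDeriv Φ e₄ q a) (e₃ q)) * hw3

end LorentzMetric
end Spacetime

/-! ### Local coordinates on the unit sphere -/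

theorem inner_eq_sum {m : ℕ} (v w : Eu m) : inner ℝ v w = ∑ i, v i * w i := by
  simp [PiLp.inner_apply, mul_comm]

namespace IsSphereCoordinates

variable {W : Set (Eu 2)} {X : Eu 2 → Eu 3} {q : Eu 2}

theorem contDiffAt (hX : IsSphereCoordinates W X) (hq : q ∈ W) : ContDiffAt ℝ ∞ X q :=
  hX.smooth.contDiffAt (hX.isOpen.mem_nhds hq)

theorem differentiableAt (hX : IsSphereCoordinates W X) (hq : q ∈ W) : DifferentiableAt ℝ X q :=
  (hX.contDiffAt hq).differentiableAt (by simp)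

theorem inner_self (hX : IsSphereCoordinates W X) (hq : q ∈ W) : inner ℝ (X q) (X q) = (1 : ℝ) := by
  rw [real_inner_self_eq_norm_sq, hX.norm_eq_one q hq, one_pow]

theorem inner_pderiv (hX : IsSphereCoordinates W X) (hq : q ∈ W) (a : Fin 2) :
    inner ℝ (X q) (pderiv X q a) = (0 : ℝ) := by
  have hd := (hX.differentiableAt hq).hasFDerivAt
  have h1 := hd.inner ℝ hd
  have h2 : (fun q' => (inner ℝ (X q') (X q') : ℝ)) =ᶠ[𝓝 q] fun _ => 1 := by
    filter_upwards [hX.isOpen.mem_nhds hq] with q' hq' using hX.inner_self hq'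
  have h3 := h1.fderiv
  rw [h2.fderiv_eq] at h3
  have h4 := DFunLike.congr_fun h3 (stdVec a)
  simp [real_inner_comm] at h4
  unfold pderiv
  linarith

theorem isUnit_det_roundMetric (hX : IsSphereCoordinates W X) (hq : q ∈ W) :
    IsUnit (roundMetric X q).det :=
  (Matrix.isUnit_iff_isUnit_det _).1
    (Matrix.posDef_gram_of_linearIndependent (𝕜 := ℝ) (hX.immersion q hq)).isUnit

/-- The inverse round metric is the projection onto the tangent plane of the sphere. -/
theorem sum_inv_roundMetric_mul (hX : IsSphereCoordinates W X) (hq : q ∈ W) (i j : Fin 3) :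
    ∑ a, ∑ b, (roundMetric X q)⁻¹ a b * pderiv X q a i * pderiv X q b j =
      (if i = j then 1 else 0) - X q i * X q j := by
  set A : Matrix (Fin 3) (Fin 2) ℝ := Matrix.of fun i a => pderiv X q a i with hA
  set x : Matrix (Fin 3) (Fin 1) ℝ := Matrix.of fun i _ => X q i with hx
  have hAA : Aᵀ * A = roundMetric X q := by
    ext a b
    simp [hA, Matrix.mul_apply, roundMetric, inner_eq_sum]
  have hAx : Aᵀ * x = 0 := by
    ext a b
    have := hX.inner_pderiv hq a
    rw [inner_eq_sum] at this
    simpa [hA, hx, Matrix.mul_apply, mul_comm] using this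
  have hxA : xᵀ * A = 0 := by
    have := congrArg Matrix.transpose hAx
    simpa using this
  have hxx : xᵀ * x = 1 := by
    ext a b
    have := hX.inner_self hq
    rw [inner_eq_sum] at this
    simpa [hx, Matrix.mul_apply, Matrix.one_apply, Subsingleton.elim a b] using this
  -- The block matrix `(A | x)` is square, of size 3, so this left inverse is also a right inverse.
  -- The reversed product reads `A σ̃⁻¹ Aᵀ + x xᵀ = 1`.
  have h1 : Matrix.fromRows ((roundMetric X q)⁻¹ * Aᵀ) xᵀ * Matrix.fromCols A x = 1 := by
    rw [Matrix.fromRows_mul_fromCols, Matrix.mul_assoc, hAA, Matrix.mul_assoc, hAx, hxA, hxx,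
      Matrix.nonsing_inv_mul _ (hX.isUnit_det_roundMetric hq), Matrix.mul_zero,
      Matrix.fromBlocks_one]
  have h2 := (Matrix.mul_eq_one_comm_of_card_eq _ _ _ (by simp)).1 h1
  rw [Matrix.fromCols_mul_fromRows] at h2
  replace h2 := congrFun (congrFun h2 i) j
  rw [← Matrix.mul_assoc, Matrix.add_apply, Matrix.one_apply] at h2
  rw [← h2]
  simp [Matrix.mul_apply, hA, hx]
  ring

theorem sum_inv_roundMetric_mul_roundMetric (hX : IsSphereCoordinates W X) (hq : q ∈ W) :
    ∑ a, ∑ b, (roundMetric X q)⁻¹ a b * roundMetric X q a b = 2 := by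
  have h1 := congrArg Matrix.trace (Matrix.nonsing_inv_mul _ (hX.isUnit_det_roundMetric hq))
  rw [Matrix.trace_one, Fintype.card_fin] at h1
  rw [Matrix.trace] at h1
  simp only [Matrix.diag_apply, Matrix.mul_apply] at h1
  have h2 : ∀ a b, roundMetric X q a b = roundMetric X q b a := fun a b => real_inner_comm (pderiv X q b) (pderiv X q a)
  rw [← show ((2 : ℕ) : ℝ) = 2 by norm_num, ← h1]
  refine Finset.sum_congr rfl fun a _ => Finset.sum_congr rfl fun b _ => ?_
  rw [h2 a b]

/-- A vector orthogonal to the tangent plane of the sphere is radial. -/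
theorem eq_smul_of_orthogonal (hX : IsSphereCoordinates W X) (hq : q ∈ W) {ν : Eu 3}
    (h : ∀ a, inner ℝ ν (pderiv X q a) = (0 : ℝ)) : ν = (inner ℝ ν (X q) : ℝ) • X q := by
  ext i
  have h1 : ∑ j, (∑ a, ∑ b, (roundMetric X q)⁻¹ a b * pderiv X q a i * pderiv X q b j) * ν j =
      ∑ a, ∑ b, (roundMetric X q)⁻¹ a b * pderiv X q a i * inner ℝ ν (pderiv X q b) := by
    simp only [inner_eq_sum, Fin.sum_univ_three, Fin.sum_univ_two]
    ring
  simp only [hX.sum_inv_roundMetric_mul hq, h, mul_zero, Finset.sum_const_zero, sub_mul, ite_mul,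
    one_mul, zero_mul, Finset.sum_sub_distrib, Finset.sum_ite_eq, Finset.mem_univ, if_true] at h1
  rw [inner_eq_sum, PiLp.smul_apply, smul_eq_mul, Finset.sum_mul, sub_eq_zero.1 h1]
  exact Finset.sum_congr rfl fun j _ => by ring

end IsSphereCoordinates

/-- The chain rule gives `∂ᵣ(u⁻²) = -2 u⁻³ du(X)`. This form can be compared with the trace of the
second fundamental form and visibly depends differentiably on `X`. -/
theorem hBar_eq {u : Eu 3 → ℝ} {r : ℝ} {X : Eu 3} (hu : DifferentiableAt ℝ u (r • X))
    (h0 : u (r • X) ≠ 0) :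
    hBar u r X = 2 * r⁻¹ * u (r • X) ^ (-2 : ℤ) +
      4 * u (r • X) ^ (-3 : ℤ) * fderiv ℝ u (r • X) X := by
  have h1 : HasDerivAt (fun s : ℝ => s • X) X r := by
    simpa using (hasDerivAt_id r).smul_const X
  have h2 := (hasDerivAt_zpow (-2) (u (r • X)) (Or.inl h0)).comp r
    (hu.hasFDerivAt.comp_hasDerivAt r h1)
  rw [hBar, show (fun s : ℝ => u (s • X) ^ (-2 : ℤ)) =
    (fun x : ℝ => x ^ (-2 : ℤ)) ∘ (u ∘ fun s : ℝ => s • X) from rfl, h2.deriv]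
  norm_num
  ring

/-! ### Coordinate spheres in conformally flat initial data -/

namespace LorentzMetric

variable {N : Type*} [TopologicalSpace N] [ChartedSpace (Eu 4) N] [IsManifold (𝓡 4) ∞ N]

/-- A coordinate sphere, with local coordinates, in a conformally flat initial data set. -/
structure IsConformalSphere (G : LorentzMetric N) (Ω : Set (Eu 3)) (u : Eu 3 → ℝ)
    (k : Eu 3 → Matrix (Fin 3) (Fin 3) ℝ) (F : Eu 3 → N) (n : ∀ x, TangentSpace (𝓡 4) (F x))
    (r : ℝ) (W : Set (Eu 2)) (X : Eu 2 → Eu 3) : Prop where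
  isOpen : IsOpen Ω
  smooth_factor : ContDiffOn ℝ ∞ u Ω
  factor_pos : ∀ x ∈ Ω, 0 < u x
  realizes : G.RealizesInitialData Ω (fun x => u x ^ 4 • (1 : Matrix (Fin 3) (Fin 3) ℝ)) k F n
  radius_pos : 0 < r
  sphere_subset : Metric.sphere (0 : Eu 3) r ⊆ Ω
  coordinates : IsSphereCoordinates W X

/-- The vector field `u⁻² ∂ᵣ` along the coordinate sphere of radius `r`. -/
def radialNormal (u : Eu 3 → ℝ) (F : Eu 3 → N) (r : ℝ) (X : Eu 2 → Eu 3) (q : Eu 2) :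
    TangentSpace (𝓡 4) (F (r • X q)) :=
  u (r • X q) ^ (-2 : ℤ) • mfderiv (𝓡 3) (𝓡 4) F (r • X q) (X q)

namespace IsConformalSphere

variable {G : LorentzMetric N} {Ω : Set (Eu 3)} {u : Eu 3 → ℝ}
  {k : Eu 3 → Matrix (Fin 3) (Fin 3) ℝ} {F : Eu 3 → N} {n : ∀ x, TangentSpace (𝓡 4) (F x)}
  {r : ℝ} {W : Set (Eu 2)} {X : Eu 2 → Eu 3}

theorem mem_nhds (S : G.IsConformalSphere Ω u k F n r W X) {x : Eu 3} (hx : x ∈ Ω) : Ω ∈ 𝓝 x :=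
  S.isOpen.mem_nhds hx

theorem contMDiffAt (S : G.IsConformalSphere Ω u k F n r W X) {x : Eu 3} (hx : x ∈ Ω) :
    ContMDiffAt (𝓡 3) (𝓡 4) ∞ F x :=
  S.realizes.smooth_map.contMDiffAt (S.mem_nhds hx)

theorem contDiffAt_factor (S : G.IsConformalSphere Ω u k F n r W X) {x : Eu 3} (hx : x ∈ Ω) :
    ContDiffAt ℝ ∞ u x :=
  S.smooth_factor.contDiffAt (S.mem_nhds hx)

theorem differentiableAt_factor (S : G.IsConformalSphere Ω u k F n r W X) {x : Eu 3} (hx : x ∈ Ω) :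
    DifferentiableAt ℝ u x :=
  (S.contDiffAt_factor hx).differentiableAt (by simp)

theorem differentiableAlong_normal (S : G.IsConformalSphere Ω u k F n r W X) {x : Eu 3}
    (hx : x ∈ Ω) : DifferentiableAlong F n x :=
  differentiableAlong_of_contMDiffAt (S.realizes.smooth_normal.contMDiffAt (S.mem_nhds hx))

theorem val_coordVec (S : G.IsConformalSphere Ω u k F n r W X) {x : Eu 3} (hx : x ∈ Ω)
    (i j : Fin 3) :
    G.val (F x) (coordVec F x i) (coordVec F x j) = u x ^ 4 * if i = j then 1 else 0 := by
  have := congrFun (congrFun (S.realizes.metric_eq x hx) i) j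
  simpa [inducedMetric, Matrix.one_apply] using this

theorem val_mfderiv (S : G.IsConformalSphere Ω u k F n r W X) {x : Eu 3} (hx : x ∈ Ω)
    (v w : Eu 3) :
    G.val (F x) (mfderiv (𝓡 3) (𝓡 4) F x v) (mfderiv (𝓡 3) (𝓡 4) F x w) =
      u x ^ 4 * inner ℝ v w := by
  rw [mfderiv_eq_sum_coordVec, mfderiv_eq_sum_coordVec, inner_eq_sum]
  simp only [map_sum, LinearMap.sum_apply, map_smul, LinearMap.smul_apply, smul_eq_mul,
    S.val_coordVec hx, mul_ite, mul_one, mul_zero]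
  rw [Finset.mul_sum]
  exact Finset.sum_congr rfl fun i _ => by simp; ring

theorem val_normal_mfderiv (S : G.IsConformalSphere Ω u k F n r W X) {x : Eu 3} (hx : x ∈ Ω)
    (v : Eu 3) : G.val (F x) (n x) (mfderiv (𝓡 3) (𝓡 4) F x v) = 0 := by
  rw [mfderiv_eq_sum_coordVec]
  simp [S.realizes.normal_orthogonal x hx]

/-- Tangential components of the ambient derivative depend only on the induced metric: this is
Koszul's formula with `∂ᵢ(u⁴ δⱼₗ) = 4u³ ∂ᵢu δⱼₗ`. -/
theorem val_covDeriv_coordVec (S : G.IsConformalSphere Ω u k F n r W X) {x : Eu 3} (hx : x ∈ Ω)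
    (i j l : Fin 3) :
    G.val (F x) (G.covDeriv F (fun x => coordVec F x j) x i) (coordVec F x l) =
      2 * u x ^ 3 * ((if j = l then pderiv u x i else 0) + (if i = l then pderiv u x j else 0) -
        (if i = j then pderiv u x l else 0)) := by
  have h : ∀ i j l, pderiv (fun x => G.inducedMetric F x j l) x i =
      4 * u x ^ 3 * if j = l then pderiv u x i else 0 := fun i j l => by
    have h1 : (fun x => G.inducedMetric F x j l) =ᶠ[𝓝 x]
        fun x => u x ^ 4 * if j = l then 1 else 0 := by
      filter_upwards [S.mem_nhds hx] with x hx using S.val_coordVec hx j l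
    have h2 := ((S.differentiableAt_factor hx).hasFDerivAt.pow 4).mul_const
      (if j = l then (1 : ℝ) else 0)
    rw [pderiv, h1.fderiv_eq, h2.fderiv]
    split_ifs <;> simp [pderiv]
  rw [G.val_covDeriv_coordVec (S.contMDiffAt hx), h, h, h]
  ring

theorem symm_second (S : G.IsConformalSphere Ω u k F n r W X) {x : Eu 3} (hx : x ∈ Ω)
    (i j : Fin 3) : k x i j = k x j i := by
  rw [← S.realizes.second_eq x hx]
  refine G.secondFundamentalForm_symm (S.contMDiffAt hx) (S.differentiableAlong_normal hx) ?_ i j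
  filter_upwards [S.mem_nhds hx] with x hx using S.realizes.normal_orthogonal x hx

variable {q : Eu 2}

theorem smul_mem (S : G.IsConformalSphere Ω u k F n r W X) (hq : q ∈ W) : r • X q ∈ Ω :=
  S.sphere_subset (by
    rw [mem_sphere_zero_iff_norm, norm_smul, S.coordinates.norm_eq_one q hq, Real.norm_eq_abs,
      abs_of_pos S.radius_pos, mul_one])

theorem contDiffAt_smul (S : G.IsConformalSphere Ω u k F n r W X) (hq : q ∈ W) :
    ContDiffAt ℝ ∞ (fun q' => r • X q') q :=
  (S.coordinates.contDiffAt hq).const_smul r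

theorem differentiableAt_smul (S : G.IsConformalSphere Ω u k F n r W X) (hq : q ∈ W) :
    DifferentiableAt ℝ (fun q' => r • X q') q :=
  (S.contDiffAt_smul hq).differentiableAt (by simp)

theorem pderiv_smul (S : G.IsConformalSphere Ω u k F n r W X) (hq : q ∈ W) (a : Fin 2) :
    pderiv (fun q' => r • X q') q a = r • pderiv X q a := by
  unfold pderiv
  rw [fderiv_fun_const_smul (S.coordinates.differentiableAt hq)]; rfl

theorem contMDiffAt_comp (S : G.IsConformalSphere Ω u k F n r W X) (hq : q ∈ W) :
    ContMDiffAt (𝓡 2) (𝓡 4) ∞ (fun q' => F (r • X q')) q :=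
  ContMDiffAt.comp q (g := F) (f := fun q' => r • X q') (S.contMDiffAt (S.smul_mem hq))
    (contMDiffAt_iff_contDiffAt.2 (S.contDiffAt_smul hq))

theorem coordVec_comp (S : G.IsConformalSphere Ω u k F n r W X) (hq : q ∈ W) (a : Fin 2) :
    coordVec (fun q' => F (r • X q')) q a =
      mfderiv (𝓡 3) (𝓡 4) F (r • X q) (r • pderiv X q a) := by
  have h := mfderiv_comp q (g := F) (f := fun q' => r • X q')
    ((S.contMDiffAt (S.smul_mem hq)).mdifferentiableAt (by simp))
    (S.differentiableAt_smul hq).mdifferentiableAt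
  rw [mfderiv_eq_fderiv] at h
  rw [← S.pderiv_smul hq]
  exact DFunLike.congr_fun h (stdVec a)

theorem inducedMetric_eq (S : G.IsConformalSphere Ω u k F n r W X) (hq : q ∈ W) :
    G.inducedMetric (fun q' => F (r • X q')) q = (u (r • X q) ^ 4 * r ^ 2) • roundMetric X q := by
  ext a b
  simp only [inducedMetric, Matrix.of_apply, S.coordVec_comp hq]
  rw [S.val_mfderiv (S.smul_mem hq), inner_smul_left, inner_smul_right]
  simp [roundMetric]
  ring

theorem factor_ne_zero (S : G.IsConformalSphere Ω u k F n r W X) (hq : q ∈ W) : u (r • X q) ≠ 0 :=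
  (S.factor_pos _ (S.smul_mem hq)).ne'

theorem conformal_factor_ne_zero (S : G.IsConformalSphere Ω u k F n r W X) (hq : q ∈ W) :
    u (r • X q) ^ 4 * r ^ 2 ≠ 0 :=
  mul_ne_zero (pow_ne_zero _ (S.factor_ne_zero hq)) (pow_ne_zero _ S.radius_pos.ne')

theorem isUnit_det (S : G.IsConformalSphere Ω u k F n r W X) (hq : q ∈ W) :
    IsUnit (G.inducedMetric (fun q' => F (r • X q')) q).det := by
  rw [S.inducedMetric_eq hq, Matrix.det_smul]
  exact ((isUnit_iff_ne_zero.2 (S.conformal_factor_ne_zero hq)).pow _).mul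
    (S.coordinates.isUnit_det_roundMetric hq)

theorem inv_inducedMetric (S : G.IsConformalSphere Ω u k F n r W X) (hq : q ∈ W) :
    (G.inducedMetric (fun q' => F (r • X q')) q)⁻¹ =
      (u (r • X q) ^ 4 * r ^ 2)⁻¹ • (roundMetric X q)⁻¹ := by
  rw [S.inducedMetric_eq hq]
  refine Matrix.inv_eq_right_inv ?_
  rw [smul_mul_smul_comm, mul_inv_cancel₀ (S.conformal_factor_ne_zero hq), one_smul,
    Matrix.mul_nonsing_inv _ (S.coordinates.isUnit_det_roundMetric hq)]

theorem isNormalFrame (S : G.IsConformalSphere Ω u k F n r W X) (hq : q ∈ W) :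
    G.IsNormalFrame (fun q' => F (r • X q')) q (radialNormal u F r X q) (n (r • X q)) where
  isUnit_det := S.isUnit_det hq
  unit_three := by
    have h0 := S.factor_ne_zero hq
    simp only [radialNormal, map_smul, LinearMap.smul_apply, smul_eq_mul,
      S.val_mfderiv (S.smul_mem hq), S.coordinates.inner_self hq]
    field_simp
  unit_four := S.realizes.normal_unit _ (S.smul_mem hq)
  orthogonal := by
    rw [G.symm]
    simp only [radialNormal, map_smul, S.val_normal_mfderiv (S.smul_mem hq), smul_zero]
  normal_three a := by
    rw [S.coordVec_comp hq]
    simp only [radialNormal, map_smul, LinearMap.smul_apply, smul_eq_mul,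
      S.val_mfderiv (S.smul_mem hq)]
    rw [inner_smul_right, S.coordinates.inner_pderiv hq]
    ring
  normal_four a := by
    rw [S.coordVec_comp hq, S.val_normal_mfderiv (S.smul_mem hq)]

/-- By conformality, orthogonality to the sphere is Euclidean orthogonality, so `ν = tX`. Unit
length gives `(t u²)² = 1`, and pointing outward selects `t = u⁻²`. -/
theorem outwardUnitNormal_eq (S : G.IsConformalSphere Ω u k F n r W X)
    {e₃ : ∀ q, TangentSpace (𝓡 4) (F (r • X q))} (he : G.IsOutwardUnitNormal F r W X e₃)
    (hq : q ∈ W) : e₃ q = radialNormal u F r X q := by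
  have hx := S.smul_mem hq
  have hu := S.factor_pos _ hx
  obtain ⟨ν, hν, hpos⟩ := he.outward q hq
  have h1 : ∀ a, inner ℝ ν (pderiv X q a) = (0 : ℝ) := fun a => by
    have h := he.orthogonal q hq a
    rw [S.coordVec_comp hq, hν, S.val_mfderiv hx, inner_smul_right] at h
    simpa [hu.ne', S.radius_pos.ne'] using h
  have h2 := S.coordinates.eq_smul_of_orthogonal hq h1
  set t : ℝ := inner ℝ ν (X q) with ht
  have h3 := he.unit q hq
  rw [hν, S.val_mfderiv hx, h2, inner_smul_left, inner_smul_right,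
    S.coordinates.inner_self hq] at h3
  simp only [conj_trivial, mul_one] at h3
  have h4 : t * u (r • X q) ^ 2 = 1 := by
    have h5 : (t * u (r • X q) ^ 2) ^ 2 = 1 := by rw [← h3]; ring
    have h6 : 0 < t * u (r • X q) ^ 2 := by positivity
    nlinarith
  have h7 : t = u (r • X q) ^ (-2 : ℤ) := by
    rw [zpow_neg]; exact eq_inv_of_mul_eq_one_left (by exact_mod_cast h4)
  rw [hν, h2, radialNormal, ← h7]
  exact map_smul (mfderiv (𝓡 3) (𝓡 4) F (r • X q)) t (X q)

theorem covDeriv_normal (S : G.IsConformalSphere Ω u k F n r W X) (hq : q ∈ W) (a : Fin 2) :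
    G.covDeriv (fun q' => F (r • X q')) (fun q' => n (r • X q')) q a =
      ∑ i, (r * pderiv X q a i) • G.covDeriv F n (r • X q) i := by
  have h := G.covDeriv_comp (f := fun q' => r • X q')
    (S.differentiableAlong_normal (S.smul_mem hq)) (S.differentiableAt_smul hq) a
  rw [S.pderiv_smul hq] at h
  exact h

/-- `⟨∇ₐ e₄, F_* w⟩ = r k(∂ₐX, w)`. -/
theorem val_covDeriv_normal_mfderiv (S : G.IsConformalSphere Ω u k F n r W X) (hq : q ∈ W)
    (a : Fin 2) (w : Eu 3) :
    G.val (F (r • X q)) (G.covDeriv (fun q' => F (r • X q')) (fun q' => n (r • X q')) q a)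
        (mfderiv (𝓡 3) (𝓡 4) F (r • X q) w) =
      ∑ i, ∑ j, r * pderiv X q a i * w j * k (r • X q) i j := by
  rw [S.covDeriv_normal hq, mfderiv_eq_sum_coordVec, ← S.realizes.second_eq _ (S.smul_mem hq)]
  simp only [map_sum, LinearMap.sum_apply, map_smul, LinearMap.smul_apply, smul_eq_mul,
    Finset.mul_sum]
  rw [Finset.sum_comm]
  refine Finset.sum_congr rfl fun i _ => Finset.sum_congr rfl fun j _ => ?_
  simp only [secondFundamentalForm, Matrix.of_apply]
  ring

/-- The derivative produces `k(∂ₐ, ∂ᵣ)`, and the symmetry of `k` turns it into `k_{ra}`. -/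
theorem val_covDeriv_normal_radialNormal (S : G.IsConformalSphere Ω u k F n r W X) (hq : q ∈ W)
    (a : Fin 2) :
    G.val (F (r • X q)) (G.covDeriv (fun q' => F (r • X q')) (fun q' => n (r • X q')) q a)
        (radialNormal u F r X q) = u (r • X q) ^ (-2 : ℤ) * kRadial k r X q a := by
  rw [radialNormal, map_smul, S.val_covDeriv_normal_mfderiv hq, kRadial, Finset.sum_comm,
    smul_eq_mul]
  congr 1
  refine Finset.sum_congr rfl fun i _ => Finset.sum_congr rfl fun j _ => ?_
  rw [S.symm_second (S.smul_mem hq) i j]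
  ring

-- Expansion in coordinate fields with scalar coefficients, to which the Leibniz rule applies.
omit [IsManifold (𝓡 4) ∞ N] in
theorem radialNormal_eq_sum (u : Eu 3 → ℝ) (F : Eu 3 → N) (r : ℝ) (X : Eu 2 → Eu 3) :
    radialNormal u F r X = fun q => ∑ i, (u (r • X q) ^ (-2 : ℤ) * X q i) •
      coordVec F (r • X q) i := by
  funext q
  rw [radialNormal, mfderiv_eq_sum_coordVec, Finset.smul_sum]
  simp only [smul_smul]

theorem differentiableAt_comp_factor_zpow (S : G.IsConformalSphere Ω u k F n r W X) (hq : q ∈ W)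
    (z : ℤ) : DifferentiableAt ℝ (fun q' => u (r • X q') ^ z) q :=
  DifferentiableAt.zpow (DifferentiableAt.comp (f := fun q' => r • X q') q
    (S.differentiableAt_factor (S.smul_mem hq)) (S.differentiableAt_smul hq))
    (Or.inl (S.factor_ne_zero hq))

theorem differentiableAt_coordinate (S : G.IsConformalSphere Ω u k F n r W X) (hq : q ∈ W)
    (i : Fin 3) : DifferentiableAt ℝ (fun q' => X q' i) q :=
  (hasFDerivAt_eu_apply (S.coordinates.differentiableAt hq).hasFDerivAt i).differentiableAt

theorem differentiableAlong_coordVec_comp (S : G.IsConformalSphere Ω u k F n r W X) (hq : q ∈ W)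
    (i : Fin 3) :
    DifferentiableAlong (fun q' => F (r • X q')) (fun q' => coordVec F (r • X q') i) q :=
  DifferentiableAlong.comp (f := fun q' => r • X q')
    (differentiableAlong_coordVec (S.contMDiffAt (S.smul_mem hq)) i) (S.differentiableAt_smul hq)

theorem differentiableAlong_radialNormal (S : G.IsConformalSphere Ω u k F n r W X) (hq : q ∈ W) :
    DifferentiableAlong (fun q' => F (r • X q')) (radialNormal u F r X) q := by
  have h := S.differentiableAlong_coordVec_comp hq 0
  rw [radialNormal_eq_sum]
  exact DifferentiableAlong.sum h.continuousAt h.base fun i _ =>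
    (S.differentiableAlong_coordVec_comp hq i).smul
      ((S.differentiableAt_comp_factor_zpow hq _).mul (S.differentiableAt_coordinate hq i))

theorem differentiableAlong_normal_comp (S : G.IsConformalSphere Ω u k F n r W X) (hq : q ∈ W) :
    DifferentiableAlong (fun q' => F (r • X q')) (fun q' => n (r • X q')) q :=
  DifferentiableAlong.comp (f := fun q' => r • X q')
    (S.differentiableAlong_normal (S.smul_mem hq)) (S.differentiableAt_smul hq)

theorem covDeriv_radialNormal (S : G.IsConformalSphere Ω u k F n r W X) (hq : q ∈ W) (a : Fin 2) :
    G.covDeriv (fun q' => F (r • X q')) (radialNormal u F r X) q a =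
      ∑ i, ((u (r • X q) ^ (-2 : ℤ) * pderiv X q a i +
          X q i * pderiv (fun q' => u (r • X q') ^ (-2 : ℤ)) q a) • coordVec F (r • X q) i +
        (u (r • X q) ^ (-2 : ℤ) * X q i) • ∑ j, (r * pderiv X q a j) •
          G.covDeriv F (fun x => coordVec F x i) (r • X q) j) := by
  have hu := S.differentiableAt_comp_factor_zpow hq (-2)
  have hX := S.differentiableAt_coordinate hq
  have huX : ∀ i, DifferentiableAt ℝ (fun q' => u (r • X q') ^ (-2 : ℤ) * X q' i) q :=
    fun i => hu.mul (hX i)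
  rw [radialNormal_eq_sum, G.covDeriv_sum fun i _ =>
    (S.differentiableAlong_coordVec_comp hq i).smul (huX i)]
  refine Finset.sum_congr rfl fun i _ => ?_
  have h1 := G.covDeriv_comp (f := fun q' => r • X q')
    (differentiableAlong_coordVec (S.contMDiffAt (S.smul_mem hq)) i) (S.differentiableAt_smul hq) a
  rw [S.pderiv_smul hq] at h1
  rw [G.covDeriv_smul (huX i) (S.differentiableAlong_coordVec_comp hq i), h1]
  have h2 : pderiv (fun q' => u (r • X q') ^ (-2 : ℤ) * X q' i) q a =
      u (r • X q) ^ (-2 : ℤ) * pderiv X q a i +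
        X q i * pderiv (fun q' => u (r • X q') ^ (-2 : ℤ)) q a := by
    rw [pderiv_apply (S.coordinates.differentiableAt hq)]
    unfold pderiv
    rw [fderiv_fun_mul hu (hX i)]; rfl
  rw [h2]
  rfl

/-- The second fundamental form of the coordinate sphere in the hypersurface. -/
theorem val_covDeriv_radialNormal_coordVec (S : G.IsConformalSphere Ω u k F n r W X) (hq : q ∈ W)
    (a b : Fin 2) :
    G.val (F (r • X q)) (G.covDeriv (fun q' => F (r • X q')) (radialNormal u F r X) q a)
        (coordVec (fun q' => F (r • X q')) q b) =
      (r * u (r • X q) ^ 2 + 2 * r ^ 2 * u (r • X q) * fderiv ℝ u (r • X q) (X q)) *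
        roundMetric X q a b := by
  have hx := S.smul_mem hq
  have hXa := S.coordinates.inner_pderiv hq a
  have hXb := S.coordinates.inner_pderiv hq b
  have hU : u (r • X q) ^ (-2 : ℤ) * u (r • X q) ^ 2 = 1 := by
    have h0 := S.factor_ne_zero hq
    field_simp
  rw [S.covDeriv_radialNormal hq, S.coordVec_comp hq, mfderiv_eq_sum_coordVec,
    map_eq_sum_stdVec (fderiv ℝ u (r • X q)) (X q)]
  simp only [inner_eq_sum, Fin.sum_univ_three] at hXa hXb
  simp only [roundMetric, Matrix.of_apply, inner_eq_sum]
  simp only [map_add, LinearMap.add_apply, map_smul,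
    LinearMap.smul_apply, smul_eq_mul, PiLp.smul_apply, S.val_coordVec hx,
    S.val_covDeriv_coordVec hx, Fin.sum_univ_three, Fin.isValue, Fin.reduceEq, if_true, if_false]
  simp only [← show ∀ i, pderiv u (r • X q) i = fderiv ℝ u (r • X q) (stdVec i) from fun _ => rfl]
  -- What remains is a polynomial identity modulo `u⁻² u² = 1` and the orthogonality of `X` to `∂ₐX`
  -- and `∂_bX`. The derivative `m` of `u⁻²` only multiplies `X · ∂_bX`, so its value is irrelevant.
  generalize pderiv (fun q' => u (r • X q') ^ (-2 : ℤ)) q a = m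
  generalize u (r • X q) ^ (-2 : ℤ) = U at *
  generalize u (r • X q) = v at *
  generalize pderiv u (r • X q) = d at *
  generalize pderiv X q a = A at *
  generalize pderiv X q b = B at *
  generalize X q = x at *
  linear_combination
    (r * v ^ 2 * (A 0 * B 0 + A 1 * B 1 + A 2 * B 2) + 2 * r ^ 2 * v *
      (x 0 * d 0 + x 1 * d 1 + x 2 * d 2) * (A 0 * B 0 + A 1 * B 1 + A 2 * B 2)) * hU +
    (v ^ 4 * r * m + 2 * v ^ 3 * U * r ^ 2 * (A 0 * d 0 + A 1 * d 1 + A 2 * d 2)) * hXb -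
    (2 * v ^ 3 * U * r ^ 2 * (B 0 * d 0 + B 1 * d 1 + B 2 * d 2)) * hXa

/-- Orthogonality of `∂_b` to the frame moves the derivative onto `e₃` and `n`, and the traces are
taken with `σ⁻¹ = u⁻⁴ r⁻² σ̃⁻¹`. The radial part is pure trace, with `tr σ̃ = 2`. In the timelike
part the sign of `-k` is cancelled by that of `⟨n, n⟩`, whence `+p`. -/
theorem meanCurvature_eq (S : G.IsConformalSphere Ω u k F n r W X) (hq : q ∈ W) :
    G.meanCurvature (fun q' => F (r • X q')) q =
      (-hBar u r (X q)) • radialNormal u F r X q + pFun u k r (X q) • n (r • X q) := by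
  have hx := S.smul_mem hq
  have h0 := S.factor_ne_zero hq
  have hr := S.radius_pos.ne'
  have hC : ∀ b, DifferentiableAlong (fun q' => F (r • X q'))
      (fun q' => coordVec (fun q' => F (r • X q')) q' b) q := fun b =>
    differentiableAlong_coordVec (S.contMDiffAt_comp hq) b
  have hW := S.coordinates.isOpen.mem_nhds hq
  have h3 : ∀ a b, G.val (F (r • X q)) (G.covDeriv (fun q' => F (r • X q'))
      (fun q' => coordVec (fun q' => F (r • X q')) q' b) q a) (radialNormal u F r X q) =
      -((r * u (r • X q) ^ 2 + 2 * r ^ 2 * u (r • X q) * fderiv ℝ u (r • X q) (X q)) *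
        roundMetric X q a b) := fun a b => by
    rw [← S.val_covDeriv_radialNormal_coordVec hq]
    refine G.val_covDeriv_eq_neg (c := 0) (hC b) (S.differentiableAlong_radialNormal hq) ?_ a
    filter_upwards [hW] with q' hq'
    rw [G.symm]
    exact (S.isNormalFrame hq').normal_three b
  have h4 : ∀ a b, G.val (F (r • X q)) (G.covDeriv (fun q' => F (r • X q'))
      (fun q' => coordVec (fun q' => F (r • X q')) q' b) q a) (n (r • X q)) =
      -∑ i, ∑ j, r * pderiv X q a i * (r • pderiv X q b) j * k (r • X q) i j := fun a b => by
    rw [← S.val_covDeriv_normal_mfderiv hq, ← S.coordVec_comp hq]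
    refine G.val_covDeriv_eq_neg (c := 0) (hC b) (S.differentiableAlong_normal_comp hq) ?_ a
    filter_upwards [hW] with q' hq'
    rw [G.symm]
    exact (S.isNormalFrame hq').normal_four b
  rw [(S.isNormalFrame hq).meanCurvature_eq, sub_eq_add_neg, ← neg_smul]
  simp only [h3, h4, S.inv_inducedMetric hq, Matrix.smul_apply, smul_eq_mul]
  congr 2
  · rw [hBar_eq (S.differentiableAt_factor hx) h0]
    have ht := S.coordinates.sum_inv_roundMetric_mul_roundMetric hq
    have : ∀ a b, (u (r • X q) ^ 4 * r ^ 2)⁻¹ * (roundMetric X q)⁻¹ a b *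
        -((r * u (r • X q) ^ 2 + 2 * r ^ 2 * u (r • X q) * fderiv ℝ u (r • X q) (X q)) *
        roundMetric X q a b) = -((u (r • X q) ^ 4 * r ^ 2)⁻¹ *
        (r * u (r • X q) ^ 2 + 2 * r ^ 2 * u (r • X q) * fderiv ℝ u (r • X q) (X q))) *
        ((roundMetric X q)⁻¹ a b * roundMetric X q a b) := fun a b => by ring
    simp only [this, ← Finset.mul_sum, ht]
    field_simp
    ring
  -- The projection in `p` is replaced by its expression through the inverse round metric; the
  -- factor `r²` from the two tangent vectors then cancels the `r⁻²` in `σ⁻¹`.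
  · have h5 : ∑ i, ∑ j, k (r • X q) i j *
        (∑ a, ∑ b, (roundMetric X q)⁻¹ a b * pderiv X q a i * pderiv X q b j) =
        ∑ a, ∑ b, (roundMetric X q)⁻¹ a b *
          ∑ i, ∑ j, pderiv X q a i * pderiv X q b j * k (r • X q) i j := by
      simp only [Fin.sum_univ_three, Fin.sum_univ_two]
      ring
    have h6 : pFun u k r (X q) = u (r • X q) ^ (-4 : ℤ) * ∑ a, ∑ b, (roundMetric X q)⁻¹ a b *
          ∑ i, ∑ j, pderiv X q a i * pderiv X q b j * k (r • X q) i j := by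
      rw [← h5, pFun]
      simp only [S.coordinates.sum_inv_roundMetric_mul hq]
    have h7 : ∀ a b, ∑ i, ∑ j, r * pderiv X q a i * (r • pderiv X q b) j * k (r • X q) i j =
        r ^ 2 * ∑ i, ∑ j, pderiv X q a i * pderiv X q b j * k (r • X q) i j := fun a b => by
      simp only [Finset.mul_sum, PiLp.smul_apply, smul_eq_mul]
      exact Finset.sum_congr rfl fun i _ => Finset.sum_congr rfl fun j _ => by ring
    rw [h6]
    simp only [h7, ← Finset.sum_neg_distrib, Finset.mul_sum (s := (Finset.univ : Finset (Fin 2)))]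
    refine Finset.sum_congr rfl fun a _ => Finset.sum_congr rfl fun b _ => ?_
    field_simp

theorem differentiableAt_hBar (S : G.IsConformalSphere Ω u k F n r W X) (hq : q ∈ W) :
    DifferentiableAt ℝ (fun q' => hBar u r (X q')) q := by
  have h1 : (fun q' => hBar u r (X q')) =ᶠ[𝓝 q] fun q' => 2 * r⁻¹ * u (r • X q') ^ (-2 : ℤ) +
      4 * u (r • X q') ^ (-3 : ℤ) * fderiv ℝ u (r • X q') (X q') := by
    filter_upwards [S.coordinates.isOpen.mem_nhds hq] with q' hq'
    exact hBar_eq (S.differentiableAt_factor (S.smul_mem hq')) (S.factor_ne_zero hq')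
  refine DifferentiableAt.congr_of_eventuallyEq ?_ h1
  have h2 : DifferentiableAt ℝ (fun q' => fderiv ℝ u (r • X q')) q :=
    DifferentiableAt.comp (f := fun q' => r • X q') q
      (((S.contDiffAt_factor (S.smul_mem hq)).fderiv_right (m := ∞) (by simp)).differentiableAt
        (by simp)) (S.differentiableAt_smul hq)
  exact ((S.differentiableAt_comp_factor_zpow hq _).const_mul _).add
    (((S.differentiableAt_comp_factor_zpow hq _).const_mul _).mul
      (h2.clm_apply (S.coordinates.differentiableAt hq)))

theorem differentiableAt_pFun (S : G.IsConformalSphere Ω u k F n r W X)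
    (hk : ∀ i j, ContDiffOn ℝ ∞ (fun x => k x i j) Ω) (hq : q ∈ W) :
    DifferentiableAt ℝ (fun q' => pFun u k r (X q')) q := by
  have h1 : ∀ i j, DifferentiableAt ℝ (fun q' => k (r • X q') i j) q := fun i j =>
    DifferentiableAt.comp (f := fun q' => r • X q') (g := fun x => k x i j) q
      (((hk i j).contDiffAt (S.mem_nhds (S.smul_mem hq))).differentiableAt (by simp))
      (S.differentiableAt_smul hq)
  have h2 := S.differentiableAt_coordinate hq
  unfold pFun
  exact (S.differentiableAt_comp_factor_zpow hq _).mul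
    (DifferentiableAt.fun_sum fun i _ => DifferentiableAt.fun_sum fun j _ =>
      (h1 i j).mul (((h2 i).mul (h2 j)).const_sub _))

end IsConformalSphere
end LorentzMetric
end

/-! ### The induced metric, mean curvature and connection form of the sphere -/

theorem mainTheorem4 {N : Type*} [TopologicalSpace N] [ChartedSpace (Eu 4) N]
    [IsManifold (𝓡 4) ∞ N] (G : LorentzMetric N)
    (Ω : Set (Eu 3)) (hΩ : IsOpen Ω)
    (u : Eu 3 → ℝ) (hu : ContDiffOn ℝ ∞ u Ω) (hu_pos : ∀ x ∈ Ω, 0 < u x)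
    (k : Eu 3 → Matrix (Fin 3) (Fin 3) ℝ)
    (hk : ∀ i j, ContDiffOn ℝ ∞ (fun x => k x i j) Ω)
    (F : Eu 3 → N) (n : ∀ x, TangentSpace (𝓡 4) (F x))
    (hF : G.RealizesInitialData Ω (fun x => u x ^ 4 • (1 : Matrix (Fin 3) (Fin 3) ℝ)) k F n)
    (r : ℝ) (hr : 0 < r) (hrΩ : Metric.sphere (0 : Eu 3) r ⊆ Ω)
    (W : Set (Eu 2)) (X : Eu 2 → Eu 3) (hX : IsSphereCoordinates W X)
    (e₃ : ∀ q, TangentSpace (𝓡 4) (F (r • X q))) (he₃ : G.IsOutwardUnitNormal F r W X e₃) :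
    ∀ q ∈ W,
      G.inducedMetric (fun q' => F (r • X q')) q
          = (u (r • X q) ^ 4 * r ^ 2) • roundMetric X q ∧
      (0 < G.meanCurvatureSq (fun q' => F (r • X q')) q →
        0 < hBar u r (X q) ^ 2 - pFun u k r (X q) ^ 2 ∧
        G.meanCurvatureNorm (fun q' => F (r • X q')) q
            = Real.sqrt (hBar u r (X q) ^ 2 - pFun u k r (X q) ^ 2) ∧
        ∀ a : Fin 2,
          G.connectionForm (fun q' => F (r • X q')) e₃ (fun q' => n (r • X q')) q a
            = (hBar u r (X q) * pderiv (fun q' => pFun u k r (X q')) q a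
                - pFun u k r (X q) * pderiv (fun q' => hBar u r (X q')) q a)
                / (hBar u r (X q) ^ 2 - pFun u k r (X q) ^ 2)
              - u (r • X q) ^ (-2 : ℤ) * kRadial k r X q a) := by
  intro q hq
  have S : G.IsConformalSphere Ω u k F n r W X := ⟨hΩ, hu, hu_pos, hF, hr, hrΩ, hX⟩
  have hW := hX.isOpen.mem_nhds hq
  -- No regularity of `e₃` is assumed; it is inherited from the explicit field `u⁻² ∂ᵣ`, with which
  -- `e₃` agrees on the open set `W`.
  have he : ∀ q' ∈ W, e₃ q' = LorentzMetric.radialNormal u F r X q' :=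
    fun q' hq' => S.outwardUnitNormal_eq he₃ hq'
  -- This identity holds whatever the causal character of `H`, so `H` is spacelike exactly when `h̄²
  -- - p² > 0`.
  have hsq : G.meanCurvatureSq (fun q' => F (r • X q')) q =
      hBar u r (X q) ^ 2 - pFun u k r (X q) ^ 2 := by
    rw [LorentzMetric.meanCurvatureSq, S.meanCurvature_eq hq,
      (S.isNormalFrame hq).val_combination, neg_sq]
  refine ⟨S.inducedMetric_eq hq, fun hpos => ?_⟩
  rw [hsq] at hpos
  refine ⟨hpos, by rw [LorentzMetric.meanCurvatureNorm, hsq], fun a => ?_⟩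
  rw [← S.val_covDeriv_normal_radialNormal hq, ← he q hq]
  refine G.connectionForm_eq (h := fun q' => hBar u r (X q')) (p := fun q' => pFun u k r (X q'))
    ?_ ?_ (S.differentiableAt_hBar hq) (S.differentiableAt_pFun hk hq)
    ((S.differentiableAlong_radialNormal hq).congr ?_) (S.differentiableAlong_normal_comp hq) hpos a
  · filter_upwards [hW] with q' hq'
    rw [he q' hq']
    exact S.isNormalFrame hq'
  · filter_upwards [hW] with q' hq'
    rw [he q' hq']
    exact S.meanCurvature_eq hq'
  · filter_upwards [hW] with q' hq' using he q' hq'
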